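/- **Setting.** Let $\mathcal X$ be a measurable space, $\mathcal Y=\{0,1\}$, $\Delta$ the simplex of probability vectors on $\mathcal Y$, and $e_y\in\Delta$ the vertex of the label $y$. There are $M$ clients; client $j$ has a probability distribution $\mathcal D_j$ on $\mathcal X\times\mathcal Y$ and $n_j$ samples, $n_j$ even; $n=\sum_j n_j$ and $\bar{\mathcal D}=\sum_j\frac{n_j}{n}\mathcal D_j$. All samples are independent, those of client $j$ having law $\mathcal D_j$, and each local dataset is split into two halves $\mathcal S_j'$, $\mathcal S_j''$ of size $n_j/2$; $\mathcal S'=\bigcup_j\mathcal S'_j$. Let $l:\Delta\times\mathcal Y\to[0,\infty)$ be a loss that is bounded, convex in its first argument, and equal to the classification error on deterministic predictions: $l(e_{y'},y)=\mathbb 1_{\{y'\neq y\}}$. For a distribution $\mathcal D$ put $\mathcal L_{\mathcal D}(h)=\mathbb E_{(x,y)\sim\mathcal D}[l(h(x),y)]$. Let $\mathcal H$ be a class of measurable maps $h:\mathcal X\to\Delta$ with finite VC dimension $d_{\mathcal H}\le n$ (the VC dimension of the family of subgraphs $\{(x,t): t<h(x)_1\}$, which for deterministic classifiers is the usual VC dimension),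 and let $$\mathrm{disc}_{\mathcal H}(\mathcal D,\mathcal D')=\sup_{h\in\mathcal H}|\mathcal L_{\mathcal D}(h)-\mathcal L_{\mathcal D'}(h)|.$$ For every training sample $\mathcal S'$ let $h_{\mathcal S'}\in\mathcal H$ minimize over $\mathcal H$ the empirical risk on $\mathcal S'$. Let $\phi_h:\mathcal X\to[0,1]^p$ be a representation attached to each $h\in\mathcal H$; assume that $(\mathcal S',x)\mapsto h_{\mathcal S'}(x)$ and $(\mathcal S',x)\mapsto\phi_{h_{\mathcal S'}}(x)$ are measurable. Fix a client $m$ with $n_m>0$ and $\lambda_m\in(0,1)$. Let $h^{(1)}_{\mathcal S_m'',\mathcal S'}(x)=e_{y}$, where $y$ is the label of a point of $\mathcal S_m''$ whose representation under $\phi_{h_{\mathcal S'}}$ is nearest to $\phi_{h_{\mathcal S'}}(x)$ in Euclidean distance (ties are broken by a measurable rule depending only on the representations), and let $$h_{m,\lambda_m}=\lambda_m\,h^{(1)}_{\mathcal S_m'',\mathcal S'}+(1-\lambda_m)\,h_{\mathcal S'}.$$ Let $\eta_m(x)=\mathcal D_m(y=1\mid x)$ (a version) and let $h_m^*\in\arg\min_{h\in\mathcal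 H}\mathcal L_{\mathcal D_m}(h)$. Assume that the Bayes rule $x\mapsto e_{\mathbb 1\{\eta_m(x)>1/2\}}$ has risk at most $\mathcal L_{\mathcal D_m}(h_m^*)$, that is, no hypothesis of $\mathcal H$ beats it; in particular, if the Bayes rule belongs to $\mathcal H$, then $\mathcal L_{\mathcal D_m}(h^*_m)$ is the risk of the Bayes rule. Assume finally that for real constants $\gamma_1,\gamma_2$, all $\mathcal S'$ and all $x,x'\in\mathcal X$, $$|\eta_m(x)-\eta_m(x')|\le\Big(\gamma_1+\gamma_2\big[\mathcal L_{\mathcal D_m}(h_{\mathcal S'})-\mathcal L_{\mathcal D_m}(h_m^*)\big]\Big)\,\big\|\phi_{h_{\mathcal S'}}(x)-\phi_{h_{\mathcal S'}}(x')\big\|_2 .$$ **Theorem.** There are constants $c_1,\dots,c_5\in\mathbb R$ that depend only on $\gamma_1,\gamma_2$ such that in every such setting $$\begin{aligned}\mathbb E_{\mathcal S}\big[\mathcal L_{\mathcal D_m}(h_{m,\lambda_m})\big]\le{}&(1+\lambda_m)\,\mathcal L_{\mathcal D_m}(h_m^*)+c_1(1-\lambda_m)\,\mathrm{disc}_{\mathcal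 H}(\bar{\mathcal D},\mathcal D_m)+c_2\lambda_m\frac{\sqrt p}{n_m^{1/(p+1)}}\big(\mathrm{disc}_{\mathcal H}(\bar{\mathcal D},\mathcal D_m)+1\big)\\&+c_3(1-\lambda_m)\sqrt{\tfrac{d_{\mathcal H}}{n}}\sqrt{c_4+\log\tfrac{n}{d_{\mathcal H}}}+c_5\lambda_m\sqrt{\tfrac{d_{\mathcal H}}{n}}\sqrt{c_4+\log\tfrac{n}{d_{\mathcal H}}}\cdot\frac{\sqrt p}{n_m^{1/(p+1)}},\end{aligned}$$ where the last two terms are $0$ if $d_{\mathcal H}=0$. -/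

import Mathlib

open MeasureTheory
open scoped ENNReal

noncomputable section

namespace KNNPer

/-- Predictions for a binary label are vectors indexed by the two labels `0` and `1`; genuine
predictions (probability distributions over the labels) are the points of
`stdSimplex ℝ (Fin 2)`. -/
abbrev Pred : Type := Fin 2 → ℝ

/-- The deterministic prediction of the label `y`, a vertex of the simplex. -/
def vertex (y : Fin 2) : Pred := Pi.single y 1

/-- The space of representations, `ℝ^p` with the Euclidean distance. -/
abbrev Rep (p : ℕ) : Type := EuclideanSpace ℝ (Fin p)

/-! ### Loss functions -/

/-- The loss is nonnegative and bounded on the simplex. -/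
def BoundedLoss (l : Pred → Fin 2 → ℝ) : Prop :=
  ∃ B : ℝ, ∀ v ∈ stdSimplex ℝ (Fin 2), ∀ y, 0 ≤ l v y ∧ l v y ≤ B

/-- The loss is convex in the prediction. -/
def ConvexLoss (l : Pred → Fin 2 → ℝ) : Prop :=
  ∀ y, ConvexOn ℝ (stdSimplex ℝ (Fin 2)) (fun v => l v y)

/-- On deterministic predictions the loss is the classification error (the 0-1 loss). -/
def ClassificationErrorLoss (l : Pred → Fin 2 → ℝ) : Prop :=
  ∀ y' y, l (vertex y') y = if y' = y then 0 else 1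

section

variable {X : Type*}

/-! ### VC dimension -/

/-- The family `F` of subsets of `α` shatters the finite set `s`. -/
def Shatters {α : Type*} (F : Set (Set α)) (s : Finset α) : Prop :=
  ∀ t : Set α, t ⊆ ↑s → ∃ f ∈ F, ↑s ∩ f = t

/-- The family `F` has (finite) VC dimension `d`: the largest size of a shattered set is `d`. -/
def HasVCDim {α : Type*} (F : Set (Set α)) (d : ℕ) : Prop :=
  IsGreatest {k : ℕ | ∃ s : Finset α, s.card = k ∧ Shatters F s} d

/-- The subgraphs of the functions `x ↦ h(x)₁`, for `h` in the hypothesis class `H`. -/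
def subgraphs (H : Set (X → Pred)) : Set (Set (X × ℝ)) :=
  (fun h => {q : X × ℝ | q.2 < h q.1 1}) '' H

/-- The hypothesis class `H` has VC dimension `d`. For classes of probabilistic binary
classifiers this is the VC dimension of the class of subgraphs; for classes of deterministic
classifiers it is the usual VC dimension, see `hasVCDimension_iff_of_deterministic`. -/
def HasVCDimension (H : Set (X → Pred)) (d : ℕ) : Prop := HasVCDim (subgraphs H) d

/-! ### Risks, label discrepancy and optimal rules -/

variable [MeasurableSpace X]

/-- The true risk of `h` under the data distribution `D`. -/
def risk (l : Pred → Fin 2 → ℝ) (D : Measure (X × Fin 2)) (h : X → Pred) : ℝ :=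
  ∫ z, l (h z.1) z.2 ∂D

/-- The label discrepancy of two data distributions associated to the class `H`. -/
def disc (l : Pred → Fin 2 → ℝ) (H : Set (X → Pred)) (D₁ D₂ : Measure (X × Fin 2)) : ℝ :=
  ⨆ h : H, |risk l D₁ h - risk l D₂ h|

/-- `η` is a version of the conditional probability of the label `1` given the input. -/
def IsCondProb (D : Measure (X × Fin 2)) (η : X → ℝ) : Prop :=
  Measurable η ∧ ∀ B : Set X, MeasurableSet B → D.real (B ×ˢ {1}) = ∫ x in B, η x ∂D.fst

open Classical in
/-- The Bayes rule: predict the label `1` exactly where `η > 1/2`. -/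
def bayesRule (η : X → ℝ) (x : X) : Pred := vertex (if 1 / 2 < η x then 1 else 0)

/-! ### Samples, empirical risk minimization -/

/-- One half of the data of all clients: `k j` labelled points for each client `j`. -/
abbrev Sample (X : Type*) {M : ℕ} (k : Fin M → ℕ) : Type _ :=
  (j : Fin M) → Fin (k j) → X × Fin 2

/-- The law of such a sample: all points are independent, those of client `j` with law `D j`. -/
def sampleLaw {M : ℕ} (k : Fin M → ℕ) (D : Fin M → Measure (X × Fin 2)) :
    Measure (Sample X k) :=
  Measure.pi fun j => Measure.pi fun _ : Fin (k j) => D j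

/-- The mixture `D̄ = ∑ⱼ (nⱼ / n) Dⱼ`, where `n = ∑ⱼ nⱼ`. -/
def mixture {M : ℕ} (n : Fin M → ℕ) (D : Fin M → Measure (X × Fin 2)) :
    Measure (X × Fin 2) :=
  ∑ j, ((n j : ℝ≥0∞) / ((∑ i, n i : ℕ) : ℝ≥0∞)) • D j

/-- The empirical risk on the aggregated sample, client `j` having weight `kⱼ / ∑ᵢ kᵢ`. -/
def empRisk (l : Pred → Fin 2 → ℝ) {M : ℕ} {k : Fin M → ℕ} (S : Sample X k)
    (h : X → Pred) : ℝ :=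
  ∑ j, ((k j : ℝ) / ((∑ i, k i : ℕ) : ℝ)) *
    ((1 / (k j : ℝ)) * ∑ i, l (h (S j i).1) (S j i).2)

/-- `A` maps every training sample to an empirical risk minimizer in `H`. -/
def IsERM (l : Pred → Fin 2 → ℝ) (H : Set (X → Pred)) {M : ℕ} {k : Fin M → ℕ}
    (A : Sample X k → X → Pred) : Prop :=
  ∀ S, A S ∈ H ∧ ∀ h ∈ H, empRisk l S (A S) ≤ empRisk l S h

/-! ### The nearest-neighbour model and the interpolated model -/

/-- `ν keys q` is the index of a key that is nearest to the query `q`; ties are broken by an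
arbitrary measurable rule that looks only at the keys and the query. -/
def IsNearestIndex {p r : ℕ} (ν : (Fin r → Rep p) → Rep p → Fin r) : Prop :=
  Measurable (fun q : (Fin r → Rep p) × Rep p => ν q.1 q.2) ∧
    ∀ (keys : Fin r → Rep p) (q : Rep p) (j : Fin r), dist q (keys (ν keys q)) ≤ dist q (keys j)

/-- The 1-NN model with representation `f` and datastore `(f(xᵢ), yᵢ)ᵢ`. -/
def oneNN {p r : ℕ} (ν : (Fin r → Rep p) → Rep p → Fin r) (f : X → Rep p)
    (T : Fin r → X × Fin 2) (x : X) : Pred :=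
  vertex (T (ν (fun i => f (T i).1) (f x))).2

/-- The personalized model `λ · h⁽¹⁾ + (1 - λ) · h_{S'}` of client `m`, where the global model
`A S'` is trained on the first halves `S'` and the datastore is the client's second half. -/
def personalized {M p : ℕ} {k : Fin M → ℕ} (A : Sample X k → X → Pred)
    (φ : (X → Pred) → X → Rep p) (m : Fin M)
    (ν : (Fin (k m) → Rep p) → Rep p → Fin (k m)) (lam : ℝ)
    (S' S'' : Sample X k) (x : X) : Pred :=
  lam • oneNN ν (φ (A S')) (S'' m) x + (1 - lam) • A S' x

end

/-- For deterministic classifiers, the VC dimension is that of the sets `{x | g x = 1}`. -/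
theorem hasVCDimension_iff_of_deterministic {X : Type*} (G : Set (X → Fin 2)) (d : ℕ) :
    HasVCDimension ((fun g x => vertex (g x)) '' G) d ↔
      HasVCDim ((fun g => {x | g x = 1}) '' G) d := by
  classical
  have hlt : ∀ (y : Fin 2) (t : ℝ), 0 ≤ t → t < 1 → (t < vertex y 1 ↔ y = 1) := by
    intro y t h0 h1
    fin_cases y <;> simp [vertex, h0, h1]
  unfold HasVCDimension HasVCDim
  suffices h : ∀ r : ℕ,
      (∃ s : Finset (X × ℝ), s.card = r ∧
        Shatters (subgraphs ((fun g x => vertex (g x)) '' G)) s) ↔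
      ∃ s : Finset X, s.card = r ∧ Shatters ((fun g => {x | g x = 1}) '' G) s by
    simp only [h]
  intro r
  constructor
  · rintro ⟨s, hs, hsh⟩
    have key : ∀ t : Set (X × ℝ), t ⊆ ↑s →
        ∃ g ∈ G, ∀ a ∈ s, (a.2 < vertex (g a.1) 1 ↔ a ∈ t) := by
      intro t ht
      obtain ⟨f, ⟨h, ⟨g, hg, rfl⟩, rfl⟩, hf⟩ := hsh t ht
      refine ⟨g, hg, fun a ha => ?_⟩
      rw [← hf]
      simp [ha]
    have h01 : ∀ a ∈ s, 0 ≤ a.2 ∧ a.2 < 1 := by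
      intro a ha
      obtain ⟨g, -, hg⟩ := key ∅ (by simp)
      obtain ⟨g', -, hg'⟩ := key ↑s subset_rfl
      have e1 := hg a ha
      have e2 := hg' a ha
      have v0 : ∀ y : Fin 2, 0 ≤ vertex y 1 ∧ vertex y 1 ≤ 1 := by
        intro y; fin_cases y <;> simp [vertex]
      simp only [Set.mem_empty_iff_false, iff_false, not_lt] at e1
      have e3 := e2.2 (by simpa using ha)
      exact ⟨(v0 _).1.trans e1, e3.trans_le (v0 _).2⟩
    have key' : ∀ t : Set (X × ℝ), t ⊆ ↑s → ∃ g ∈ G, ∀ a ∈ s, (g a.1 = 1 ↔ a ∈ t) := by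
      intro t ht
      obtain ⟨g, hg, h⟩ := key t ht
      exact ⟨g, hg, fun a ha => by rw [← h a ha, hlt _ _ (h01 a ha).1 (h01 a ha).2]⟩
    have inj : Set.InjOn Prod.fst (s : Set (X × ℝ)) := by
      intro a ha b hb hab
      obtain ⟨g, -, h⟩ := key' {a} (by simpa using ha)
      have h1 := (h a ha).2 rfl
      rw [hab] at h1
      exact ((h b hb).1 h1).symm
    refine ⟨s.image Prod.fst, by rw [Finset.card_image_of_injOn inj, hs], fun t ht => ?_⟩
    obtain ⟨g, hg, h⟩ := key' {a | a ∈ s ∧ a.1 ∈ t} (fun a ha => ha.1)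
    refine ⟨_, ⟨g, hg, rfl⟩, ?_⟩
    ext x
    constructor
    · rintro ⟨hx, hgx⟩
      obtain ⟨a, ha, rfl⟩ := Finset.mem_image.1 (Finset.mem_coe.1 hx)
      exact ((h a ha).1 hgx).2
    · intro hx
      refine ⟨ht hx, ?_⟩
      obtain ⟨a, ha, rfl⟩ := Finset.mem_image.1 (Finset.mem_coe.1 (ht hx))
      exact (h a ha).2 ⟨ha, hx⟩
  · rintro ⟨s, hs, hsh⟩
    have inj : Function.Injective (fun x : X => ((x, 0) : X × ℝ)) :=
      fun a b hab => (Prod.mk.inj hab).1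
    refine ⟨s.image (fun x => (x, 0)), by rw [Finset.card_image_of_injective _ inj, hs],
      fun t ht => ?_⟩
    have hsub : {x : X | ((x, 0) : X × ℝ) ∈ t} ⊆ ↑s := by
      intro x hx
      obtain ⟨a, ha, hax⟩ := Finset.mem_image.1 (Finset.mem_coe.1 (ht hx))
      rw [← inj hax]
      exact ha
    obtain ⟨f, ⟨g, hg, rfl⟩, hf⟩ := hsh _ hsub
    refine ⟨_, ⟨_, ⟨g, hg, rfl⟩, rfl⟩, ?_⟩
    have hx : ∀ x : X, (x ∈ s ∧ g x = 1) ↔ ((x, 0) : X × ℝ) ∈ t := fun x =>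
      Set.ext_iff.1 hf x
    ext a
    constructor
    · rintro ⟨ha, hga⟩
      obtain ⟨x, hxs, rfl⟩ := Finset.mem_image.1 (Finset.mem_coe.1 ha)
      exact (hx x).1 ⟨hxs, (hlt _ _ le_rfl one_pos).1 hga⟩
    · intro ha
      obtain ⟨x, hxs, rfl⟩ := Finset.mem_image.1 (Finset.mem_coe.1 (ht ha))
      exact ⟨ht ha, (hlt _ _ le_rfl one_pos).2 ((hx x).2 ha).2⟩

end KNNPer

end

namespace KNNPer

/-! ### Sauer's bound and Massart's lemma -/

/-- The sign of a boolean. -/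
noncomputable def boolSign (b : Bool) : ℝ := if b then 1 else -1

theorem sum_choose_le_exp (N d : ℕ) (hd : d ≤ N) (hN : 0 < N) :
    ((∑ i ∈ Finset.Iic d, N.choose i : ℕ) : ℝ) ≤ Real.exp (d * (1 + Real.log (N / d))) := by
  rcases Nat.eq_zero_or_pos d with rfl | hd0
  · have : Finset.Iic (0 : ℕ) = {0} := rfl
    simp [this]
  have hN' : (0 : ℝ) < N := by exact_mod_cast hN
  have hd' : (0 : ℝ) < d := by exact_mod_cast hd0
  have hq0 : (0 : ℝ) < d / N := by positivity
  have hq1 : (d : ℝ) / N ≤ 1 := by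
    rw [div_le_one hN']; exact_mod_cast hd
  have hexp : Real.exp (d * (1 + Real.log (N / d))) = Real.exp d * ((N : ℝ) / d) ^ d := by
    rw [mul_add, mul_one, Real.exp_add, ← Real.log_pow, Real.exp_log (by positivity)]
  rw [hexp]
  have h1 : ((∑ i ∈ Finset.Iic d, N.choose i : ℕ) : ℝ) * ((d : ℝ) / N) ^ d ≤ Real.exp d := by
    calc ((∑ i ∈ Finset.Iic d, N.choose i : ℕ) : ℝ) * ((d : ℝ) / N) ^ d
        = ∑ i ∈ Finset.Iic d, (N.choose i : ℝ) * ((d : ℝ) / N) ^ d := by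
          push_cast; rw [Finset.sum_mul]
      _ ≤ ∑ i ∈ Finset.Iic d, (N.choose i : ℝ) * ((d : ℝ) / N) ^ i := by
          refine Finset.sum_le_sum fun i hi => ?_
          gcongr ?_ * ?_
          exact pow_le_pow_of_le_one hq0.le hq1 (Finset.mem_Iic.1 hi)
      _ ≤ ∑ i ∈ Finset.range (N + 1), (N.choose i : ℝ) * ((d : ℝ) / N) ^ i := by
          refine Finset.sum_le_sum_of_subset_of_nonneg (fun i hi => ?_) fun i _ _ => by positivity
          rw [Finset.mem_range]
          have := Finset.mem_Iic.1 hi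
          omega
      _ = ((d : ℝ) / N + 1) ^ N := by
          rw [add_pow]
          exact Finset.sum_congr rfl fun i _ => by simp [mul_comm]
      _ ≤ Real.exp ((d : ℝ) / N) ^ N := by
          gcongr
          exact Real.add_one_le_exp _
      _ = Real.exp d := by
          rw [← Real.exp_nat_mul]; congr 1; field_simp
  calc ((∑ i ∈ Finset.Iic d, N.choose i : ℕ) : ℝ)
      = ((∑ i ∈ Finset.Iic d, N.choose i : ℕ) : ℝ) * ((d : ℝ) / N) ^ d * ((N : ℝ) / d) ^ d := by
        rw [mul_assoc, ← mul_pow]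
        have : (d : ℝ) / N * (N / d) = 1 := by field_simp
        simp [this]
    _ ≤ _ := by gcongr

theorem sum_exp_sign_le {I : Type*} [Fintype I] [DecidableEq I] (w : I → ℝ)
    (hw : ∀ i, |w i| ≤ 1) (t : ℝ) :
    ∑ σ : I → Bool, Real.exp (t * ∑ i, boolSign (σ i) * w i) ≤
      2 ^ Fintype.card I * Real.exp (t ^ 2 * Fintype.card I / 2) := by
  have h1 : ∀ σ : I → Bool, Real.exp (t * ∑ i, boolSign (σ i) * w i) =
      ∏ i, Real.exp (t * (boolSign (σ i) * w i)) := fun σ => by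
    rw [Finset.mul_sum, Real.exp_sum]
  simp only [h1]
  rw [← Fintype.prod_sum (fun i b => Real.exp (t * (boolSign b * w i)))]
  have h2 : ∀ i, ∑ b : Bool, Real.exp (t * (boolSign b * w i)) ≤ 2 * Real.exp (t ^ 2 / 2) := by
    intro i
    have h3 : ∑ b : Bool, Real.exp (t * (boolSign b * w i)) = 2 * Real.cosh (t * w i) := by
      rw [Real.cosh_eq]; simp [boolSign]; ring
    rw [h3]
    gcongr
    refine (Real.cosh_le_exp_half_sq _).trans (Real.exp_le_exp.2 ?_)
    have : w i ^ 2 ≤ 1 := by rw [← sq_abs]; exact pow_le_one₀ (abs_nonneg _) (hw i)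
    have := mul_le_mul_of_nonneg_left this (sq_nonneg t)
    rw [mul_pow]; linarith
  calc ∏ i, ∑ b : Bool, Real.exp (t * (boolSign b * w i))
      ≤ ∏ _i : I, (2 * Real.exp (t ^ 2 / 2)) :=
        Finset.prod_le_prod (fun i _ => by positivity) fun i _ => h2 i
    _ = _ := by
        rw [Finset.prod_const, mul_pow, ← Real.exp_nat_mul, Finset.card_univ]
        congr 2; ring

/-- **Massart's lemma** in selector form. -/
theorem sum_sign_mul_selector_le {I : Type*} [Fintype I] [DecidableEq I]
    (F : Finset (I → ℝ)) (hF : ∀ w ∈ F, ∀ i, |w i| ≤ 1) (L : ℝ) (hL : (F.card : ℝ) ≤ Real.exp L)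
    (v : (I → Bool) → I → ℝ) (hv : ∀ σ, v σ ∈ F) :
    ∑ σ : I → Bool, ∑ i, boolSign (σ i) * v σ i ≤
      2 ^ Fintype.card I * √(2 * Fintype.card I * L) := by
  set N : ℝ := (Fintype.card I : ℝ) with hN
  set Z : (I → Bool) → ℝ := fun σ => ∑ i, boolSign (σ i) * v σ i with hZ
  have hK : (0 : ℝ) < 2 ^ Fintype.card I := by positivity
  set a : ℝ := (∑ σ, Z σ) / 2 ^ Fintype.card I with ha
  have hcard : (Fintype.card (I → Bool) : ℝ) = 2 ^ Fintype.card I := by simp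
  have key : ∀ t : ℝ, t * a ≤ L + t ^ 2 * N / 2 := by
    intro t
    have hJ := convexOn_exp.map_sum_le (t := Finset.univ)
      (w := fun _ : I → Bool => 1 / (2 : ℝ) ^ Fintype.card I) (p := fun σ => t * Z σ)
      (fun _ _ => by positivity) (by
        rw [Finset.sum_const, Finset.card_univ, nsmul_eq_mul, hcard]; field_simp)
      (fun _ _ => Set.mem_univ _)
    have e1 : ∑ σ : I → Bool, (1 / (2 : ℝ) ^ Fintype.card I) • (t * Z σ) = t * a := by
      rw [ha, ← Finset.smul_sum, ← Finset.mul_sum, smul_eq_mul]; ring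
    rw [e1, ← Finset.smul_sum, smul_eq_mul] at hJ
    have h2 : ∑ σ, Real.exp (t * Z σ) ≤
        Real.exp L * (2 ^ Fintype.card I * Real.exp (t ^ 2 * N / 2)) := by
      calc ∑ σ, Real.exp (t * Z σ)
          ≤ ∑ σ : I → Bool, ∑ w ∈ F, Real.exp (t * ∑ i, boolSign (σ i) * w i) :=
            Finset.sum_le_sum fun σ _ =>
              Finset.single_le_sum (f := fun w : I → ℝ =>
                Real.exp (t * ∑ i, boolSign (σ i) * w i)) (fun _ _ => (Real.exp_pos _).le) (hv σ)
        _ = ∑ w ∈ F, ∑ σ : I → Bool, Real.exp (t * ∑ i, boolSign (σ i) * w i) :=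
            Finset.sum_comm
        _ ≤ ∑ w ∈ F, 2 ^ Fintype.card I * Real.exp (t ^ 2 * N / 2) :=
            Finset.sum_le_sum fun w hw => sum_exp_sign_le w (hF w hw) t
        _ ≤ _ := by
            rw [Finset.sum_const, nsmul_eq_mul]; gcongr
    have h3 : Real.exp (t * a) ≤ Real.exp (L + t ^ 2 * N / 2) := by
      refine hJ.trans ?_
      rw [Real.exp_add, one_div, inv_mul_le_iff₀ hK]
      linarith
    exact Real.exp_le_exp.1 h3
  have hbound : a ≤ √(2 * N * L) := by
    rcases (Nat.cast_nonneg (α := ℝ) (Fintype.card I)).eq_or_lt with h0 | h0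
    · have : IsEmpty I := Fintype.card_eq_zero_iff.1 (by exact_mod_cast h0.symm)
      have : a = 0 := by simp [ha, hZ]
      rw [this]; positivity
    · apply Real.le_sqrt_of_sq_le
      have h1 := key (a / N)
      have h2 : a / N * a - (a / N) ^ 2 * N / 2 = a ^ 2 / (2 * N) := by
        have : N ≠ 0 := h0.ne'
        field_simp; ring
      have h3 : a ^ 2 / (2 * N) ≤ L := by linarith
      rw [div_le_iff₀ (by linarith)] at h3
      linarith
  have : ∑ σ, Z σ = 2 ^ Fintype.card I * a := by rw [ha]; field_simp
  rw [this]
  gcongr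

/-- A linear bound on the superlevel indicators of `[0,1]`-valued numbers carries over to the
numbers themselves. -/
theorem sum_mul_le_of_indicator {ι : Type*} (s : Finset ι) (c u : ι → ℝ)
    (hu0 : ∀ i ∈ s, 0 ≤ u i) (hu1 : ∀ i ∈ s, u i ≤ 1) (B : ℝ)
    (h : ∀ r : ℝ, ∑ i ∈ s, c i * (if r < u i then 1 else 0) ≤ B) :
    ∑ i ∈ s, c i * u i ≤ B := by
  have hint : ∀ a : ℝ, IntegrableOn (fun r : ℝ => if r < a then (1 : ℝ) else 0) (Set.Ioc 0 1) := by
    intro a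
    refine Measure.integrableOn_of_bounded (M := 1) (by simp)
      (Measurable.ite measurableSet_Iio measurable_const measurable_const).aestronglyMeasurable ?_
    refine Filter.Eventually.of_forall fun r => ?_
    split_ifs <;> simp
  have e1 : ∀ i ∈ s, ∫ r in Set.Ioc (0 : ℝ) 1, (if r < u i then (1 : ℝ) else 0) = u i := by
    intro i hi
    have : (fun r : ℝ => if r < u i then (1 : ℝ) else 0) = (Set.Iio (u i)).indicator 1 := by
      ext r; simp [Set.indicator_apply]
    rw [this, integral_indicator_one measurableSet_Iio, measureReal_restrict_apply measurableSet_Iio]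
    have : Set.Iio (u i) ∩ Set.Ioc 0 1 = Set.Ioo 0 (u i) := by
      have := hu1 i hi
      exact Set.ext fun r => ⟨fun h => ⟨h.2.1, h.1⟩, fun h => ⟨h.2, h.1, le_trans h.2.le this⟩⟩
    rw [this, Real.volume_real_Ioo_of_le (hu0 i hi), sub_zero]
  calc ∑ i ∈ s, c i * u i
      = ∫ r in Set.Ioc (0 : ℝ) 1, ∑ i ∈ s, c i * (if r < u i then 1 else 0) := by
        rw [integral_finsetSum _ fun i _ => (hint (u i)).const_mul (c i)]
        refine Finset.sum_congr rfl fun i hi => ?_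
        rw [integral_const_mul, e1 i hi]
    _ ≤ ∫ _r in Set.Ioc (0 : ℝ) 1, B :=
        integral_mono (integrable_finsetSum _ fun i _ => (hint (u i)).const_mul (c i))
          (integrable_const _) h
    _ = B := by simp

/-! ### Losses -/

theorem vertex_mem (y : Fin 2) : vertex y ∈ stdSimplex ℝ (Fin 2) := by
  fin_cases y <;> simp [vertex, stdSimplex, Fin.forall_fin_two]

theorem stdSimplex_sum {v : Pred} (hv : v ∈ stdSimplex ℝ (Fin 2)) : v 0 + v 1 = 1 := by
  simpa using hv.2

theorem stdSimplex_le_one {v : Pred} (hv : v ∈ stdSimplex ℝ (Fin 2)) (y : Fin 2) : v y ≤ 1 := by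
  have h := stdSimplex_sum hv
  have h0 := hv.1 0
  have h1 := hv.1 1
  fin_cases y <;> simp <;> linarith

/-- The loss decreases when the true label becomes more likely. -/
theorem loss_antitone {l : Pred → Fin 2 → ℝ} (hb : BoundedLoss l) (hc : ConvexLoss l)
    (he : ClassificationErrorLoss l) {v w : Pred} (hv : v ∈ stdSimplex ℝ (Fin 2))
    (hw : w ∈ stdSimplex ℝ (Fin 2)) (y : Fin 2) (h : w y ≤ v y) : l v y ≤ l w y := by
  obtain ⟨B, hB⟩ := hb
  have hv1 := stdSimplex_le_one hv y
  rcases (stdSimplex_le_one hw y).eq_or_lt with h1 | h1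
  · have : v = w := by
      have hs := stdSimplex_sum hv
      have hs' := stdSimplex_sum hw
      ext i
      fin_cases y <;> fin_cases i <;> simp at * <;> linarith
    rw [this]
  have hpos : 0 < 1 - w y := by linarith
  set t := (1 - v y) / (1 - w y) with ht
  have ht0 : 0 ≤ t := div_nonneg (by linarith) hpos.le
  have ht1 : t ≤ 1 := by rw [ht, div_le_one hpos]; linarith
  have htw : t * (1 - w y) = 1 - v y := by rw [ht]; field_simp
  have hcomb : v = (1 - t) • vertex y + t • w := by
    have hs := stdSimplex_sum hv
    have hs' := stdSimplex_sum hw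
    ext i
    fin_cases y <;> fin_cases i <;> simp [vertex] at * <;> nlinarith
  have h2 := (hc y).2 (vertex_mem y) hw (by linarith : 0 ≤ 1 - t) ht0 (by ring)
  rw [← hcomb] at h2
  have h3 : l (vertex y) y = 0 := by simp [he y y]
  simp only [h3, smul_eq_mul, mul_zero, zero_add] at h2
  have := (hB w hw y).1
  nlinarith

theorem loss_mem_Icc {l : Pred → Fin 2 → ℝ} (hb : BoundedLoss l) (hc : ConvexLoss l)
    (he : ClassificationErrorLoss l) {v : Pred} (hv : v ∈ stdSimplex ℝ (Fin 2)) (y : Fin 2) :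
    0 ≤ l v y ∧ l v y ≤ 1 := by
  refine ⟨(hb.choose_spec v hv y).1, ?_⟩
  have h : ∃ y' : Fin 2, y' ≠ y := ⟨y + 1, by fin_cases y <;> simp⟩
  obtain ⟨y', hy⟩ := h
  have h1 := loss_antitone hb hc he hv (vertex_mem y') y (by
    simpa [vertex, hy.symm] using hv.1 y)
  rwa [he, if_neg hy] at h1

/-- A bounded convex loss extending the classification error agrees on the simplex with a
measurable function that takes values in `[0, 1]`. -/
theorem exists_measurable_loss {l : Pred → Fin 2 → ℝ} (hb : BoundedLoss l) (hc : ConvexLoss l)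
    (he : ClassificationErrorLoss l) :
    ∃ L : Pred × Fin 2 → ℝ, Measurable L ∧ (∀ q, 0 ≤ L q ∧ L q ≤ 1) ∧
      ∀ v ∈ stdSimplex ℝ (Fin 2), ∀ y, l v y = L (v, y) := by
  let cl : ℝ → ℝ := fun t => max 0 (min 1 t)
  let e : Fin 2 → ℝ → Pred := fun y t => cl t • vertex y + (1 - cl t) • vertex (y + 1)
  have hcl : ∀ t, 0 ≤ cl t ∧ cl t ≤ 1 := fun t =>
    ⟨le_max_left _ _, max_le zero_le_one (min_le_left _ _)⟩
  have hclm : Monotone cl := fun s t h => max_le_max le_rfl (min_le_min le_rfl h)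
  have hmem : ∀ y t, e y t ∈ stdSimplex ℝ (Fin 2) := fun y t =>
    convex_stdSimplex ℝ (Fin 2) (vertex_mem y) (vertex_mem _) (hcl t).1
      (by linarith [(hcl t).2]) (by ring)
  have hey : ∀ y t, e y t y = cl t := by
    intro y t; fin_cases y <;> simp [e, vertex]
  refine ⟨fun q => l (e q.2 (q.1 q.2)) q.2, ?_, fun q => loss_mem_Icc hb hc he (hmem _ _) _, ?_⟩
  · refine measurable_from_prod_countable_left fun y => ?_
    have : Antitone fun t => l (e y t) y := fun s t h =>
      loss_antitone hb hc he (hmem _ _) (hmem _ _) y (by rw [hey, hey]; exact hclm h)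
    exact this.measurable.comp (measurable_pi_apply y)
  · intro v hv y
    have h : cl (v y) = v y := by
      simp only [cl]
      rw [min_eq_right (stdSimplex_le_one hv y), max_eq_right (hv.1 y)]
    have hee : e y (v y) y = v y := by rw [hey, h]
    exact le_antisymm (loss_antitone hb hc he hv (hmem _ _) y hee.le)
      (loss_antitone hb hc he (hmem _ _) hv y hee.ge)

/-! ### Counting the superlevel patterns of the losses -/

theorem card_le_of_shatters_thresholds {X J : Type*} [DecidableEq J] {H : Set (X → Pred)} {d : ℕ}
    (hd : HasVCDimension H d) (x : J → X) (a : J → ℝ) (s : Finset J)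
    (h : ∀ τ ⊆ s, ∃ g ∈ H, ∀ j ∈ s, (a j < g (x j) 1 ↔ j ∈ τ)) : s.card ≤ d := by
  classical
  have inj : Set.InjOn (fun j => (x j, a j)) (s : Set J) := by
    intro i hi j hj hij
    obtain ⟨g, -, hg⟩ := h {i} (by simpa using hi)
    obtain ⟨h1, h2⟩ := Prod.mk.inj hij
    have h3 := (hg i hi).2 (by simp)
    rw [h1, h2] at h3
    have := (hg j hj).1 h3
    exact (Finset.mem_singleton.1 this).symm
  refine hd.2 ⟨s.image fun j => (x j, a j), Finset.card_image_of_injOn inj, fun t ht => ?_⟩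
  obtain ⟨g, hgH, hg⟩ := h (s.filter fun j => (x j, a j) ∈ t) (Finset.filter_subset _ _)
  refine ⟨_, ⟨g, hgH, rfl⟩, ?_⟩
  ext q
  constructor
  · rintro ⟨hq, hgq⟩
    obtain ⟨j, hj, rfl⟩ := Finset.mem_image.1 (Finset.mem_coe.1 hq)
    exact (Finset.mem_filter.1 ((hg j hj).1 hgq)).2
  · intro hq
    refine ⟨ht hq, ?_⟩
    obtain ⟨j, hj, rfl⟩ := Finset.mem_image.1 (Finset.mem_coe.1 (ht hq))
    exact (hg j hj).2 (Finset.mem_filter.2 ⟨hj, hq⟩)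

/-- On a finite set of reals, an upper set is cut out by a strict inequality. -/
theorem exists_threshold (V : Finset ℝ) (P : ℝ → Prop)
    (hP : ∀ u ∈ V, ∀ v ∈ V, u ≤ v → P u → P v) : ∃ a, ∀ v ∈ V, (P v ↔ a < v) := by
  classical
  by_cases hne : (V.filter fun v => ¬ P v).Nonempty
  · refine ⟨(V.filter fun v => ¬ P v).max' hne, fun v hv => ⟨fun h => ?_, fun h => ?_⟩⟩
    · by_contra! hle
      have hm := Finset.mem_filter.1 (Finset.max'_mem _ hne)
      exact hm.2 (hP v hv _ hm.1 hle h)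
    · by_contra hn
      exact absurd (Finset.le_max' _ v (Finset.mem_filter.2 ⟨hv, hn⟩)) (not_le.2 h)
  · rw [Finset.not_nonempty_iff_eq_empty, Finset.filter_eq_empty_iff] at hne
    rcases V.eq_empty_or_nonempty with rfl | hV
    · exact ⟨0, by simp⟩
    · refine ⟨V.min' hV - 1, fun v hv => ⟨fun _ => ?_, fun _ => not_not.1 (hne hv)⟩⟩
      linarith [V.min'_le v hv]

open Classical in
/-- The superlevel pattern of the losses of `h` at the points `z`. -/
noncomputable def lossPattern {X J : Type*} [Fintype J] (l : Pred → Fin 2 → ℝ) (z : J → X × Fin 2)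
    (r : ℝ) (h : X → Pred) : Finset J :=
  Finset.univ.filter fun j => r < l (h (z j).1) (z j).2

open Classical in
/-- All superlevel patterns of the losses of hypotheses in `H` at the points `z`. -/
noncomputable def lossPatterns {X J : Type*} [Fintype J] (l : Pred → Fin 2 → ℝ)
    (H : Set (X → Pred)) (z : J → X × Fin 2) (r : ℝ) : Finset (Finset J) :=
  Finset.univ.filter fun P => ∃ h ∈ H, lossPattern l z r h = P

theorem card_lossPatterns_le {X J : Type*} [Fintype J] {l : Pred → Fin 2 → ℝ}
    (hb : BoundedLoss l) (hc : ConvexLoss l) (he : ClassificationErrorLoss l)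
    {H : Set (X → Pred)} (hH : ∀ h ∈ H, ∀ x, h x ∈ stdSimplex ℝ (Fin 2)) {d : ℕ}
    (hd : HasVCDimension H d) (z : J → X × Fin 2) (r : ℝ) :
    (lossPatterns l H z r).card ≤ ∑ i ∈ Finset.Iic d, (Fintype.card J).choose i := by
  classical
  refine (Finset.card_le_card_shatterer _).trans (Finset.card_shatterer_le_sum_vcDim.trans ?_)
  refine Finset.sum_le_sum_of_subset (Finset.Iic_subset_Iic.2 (Finset.sup_le fun s hs => ?_))
  rw [Finset.mem_shatterer] at hs
  have h1 : ∀ t : Finset J, ∃ g ∈ H, t ⊆ s →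
      ∀ j ∈ s, (r < l (g (z j).1) (z j).2 ↔ j ∈ t) := by
    intro t
    by_cases hts : t ⊆ s
    · obtain ⟨P, hP, hst⟩ := hs hts
      obtain ⟨-, g, hg, rfl⟩ := Finset.mem_filter.1 hP
      refine ⟨g, hg, fun _ j hj => ?_⟩
      rw [← hst]
      simp [lossPattern, hj]
    · obtain ⟨P, hP, -⟩ := hs subset_rfl
      obtain ⟨-, g, hg, rfl⟩ := Finset.mem_filter.1 hP
      exact ⟨g, hg, fun h => absurd h hts⟩
  choose g hgH hg using h1
  have h2 : ∀ j, ∃ a : ℝ, ∀ t : Finset J,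
      ((r < l (g t (z j).1) (z j).2 ↔ (z j).2 = 0) ↔ a < g t (z j).1 1) := by
    intro j
    obtain ⟨a, ha⟩ := exists_threshold (Finset.univ.image fun t => g t (z j).1 1)
      (fun v => ∃ t, g t (z j).1 1 = v ∧ (r < l (g t (z j).1) (z j).2 ↔ (z j).2 = 0)) (by
        rintro u - v hv huv ⟨t, rfl, ht⟩
        obtain ⟨t', -, rfl⟩ := Finset.mem_image.1 hv
        refine ⟨t', rfl, ?_⟩
        have m := hH _ (hgH t) (z j).1
        have m' := hH _ (hgH t') (z j).1
        have e := stdSimplex_sum m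
        have e' := stdSimplex_sum m'
        rcases hy : (z j).2 with ⟨y, hy2⟩
        rw [hy] at ht
        interval_cases y
        · have := loss_antitone hb hc he m m' 0 (by linarith)
          simp only [Fin.zero_eta, iff_true] at ht ⊢
          linarith
        · have := loss_antitone hb hc he m' m 1 huv
          simp only [Fin.mk_one, one_ne_zero, iff_false, not_lt] at ht ⊢
          linarith)
    refine ⟨a, fun t => ?_⟩
    rw [← ha _ (Finset.mem_image_of_mem _ (Finset.mem_univ t))]
    refine ⟨fun h => ⟨t, rfl, h⟩, ?_⟩
    rintro ⟨t', ht', h⟩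
    have m := hH _ (hgH t) (z j).1
    have m' := hH _ (hgH t') (z j).1
    have e := stdSimplex_sum m
    have e' := stdSimplex_sum m'
    have : g t' (z j).1 = g t (z j).1 := by
      ext i
      fin_cases i
      · simp; linarith
      · simpa using ht'
    rwa [this] at h
  choose a ha using h2
  refine card_le_of_shatters_thresholds hd (fun j => (z j).1) a s fun τ hτ => ?_
  refine ⟨_, hgH (s.filter fun j => (j ∈ τ ↔ (z j).2 = 0)), fun j hj => ?_⟩
  rw [← ha, hg _ (Finset.filter_subset _ _) j hj]
  simp only [Finset.mem_filter, hj, true_and]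
  tauto

/-- The Rademacher-type bound for a selection of hypotheses. -/
theorem sum_sign_loss_sub_le {X I : Type*} [Fintype I] [DecidableEq I] {l : Pred → Fin 2 → ℝ}
    (hb : BoundedLoss l) (hc : ConvexLoss l) (he : ClassificationErrorLoss l)
    {H : Set (X → Pred)} (hH : ∀ h ∈ H, ∀ x, h x ∈ stdSimplex ℝ (Fin 2)) {d : ℕ}
    (hd : HasVCDimension H d) (hI : 0 < Fintype.card I) (hdI : d ≤ 2 * Fintype.card I)
    (z z' : I → X × Fin 2) (g : (I → Bool) → X → Pred) (hg : ∀ σ, g σ ∈ H) :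
    ∑ σ : I → Bool, ∑ i, boolSign (σ i) *
        (l (g σ (z i).1) (z i).2 - l (g σ (z' i).1) (z' i).2) ≤
      2 ^ Fintype.card I * √(2 * Fintype.card I *
        (d * (1 + Real.log ((2 * Fintype.card I : ℕ) / d)))) := by
  classical
  set B : ℝ := 2 ^ Fintype.card I * √(2 * Fintype.card I *
        (d * (1 + Real.log ((2 * Fintype.card I : ℕ) / d)))) with hB
  let w : I ⊕ I → X × Fin 2 := Sum.elim z z'
  have hcJ : Fintype.card (I ⊕ I) = 2 * Fintype.card I := by simp; ring
  let c : (I → Bool) × (I ⊕ I) → ℝ := fun q =>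
    Sum.elim (fun i => boolSign (q.1 i)) (fun i => - boolSign (q.1 i)) q.2
  let u : (I → Bool) × (I ⊕ I) → ℝ := fun q => l (g q.1 (w q.2).1) (w q.2).2
  have hsplit : ∀ f : (I → Bool) × (I ⊕ I) → ℝ, ∑ q, c q * f q =
      ∑ σ : I → Bool, ∑ i, boolSign (σ i) * (f (σ, Sum.inl i) - f (σ, Sum.inr i)) := by
    intro f
    rw [Fintype.sum_prod_type]
    refine Finset.sum_congr rfl fun σ _ => ?_
    rw [Fintype.sum_sum_type, ← Finset.sum_add_distrib]
    exact Finset.sum_congr rfl fun i _ => by simp only [c, Sum.elim_inl, Sum.elim_inr]; ring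
  have hmain := sum_mul_le_of_indicator Finset.univ c u
    (fun q _ => (loss_mem_Icc hb hc he (hH _ (hg _) _) _).1)
    (fun q _ => (loss_mem_Icc hb hc he (hH _ (hg _) _) _).2) B ?_
  · rw [hsplit u] at hmain
    exact hmain
  intro r
  rw [hsplit fun q => if r < u q then 1 else 0]
  let vec : Finset (I ⊕ I) → I → ℝ := fun P i =>
    (if Sum.inl i ∈ P then 1 else 0) - (if Sum.inr i ∈ P then 1 else 0)
  have hcard : (((lossPatterns l H w r).image vec).card : ℝ) ≤
      Real.exp (d * (1 + Real.log ((2 * Fintype.card I : ℕ) / d))) := by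
    refine le_trans ?_ (sum_choose_le_exp (2 * Fintype.card I) d hdI (by omega))
    rw [← hcJ]
    exact_mod_cast Finset.card_image_le.trans (card_lossPatterns_le hb hc he hH hd w r)
  refine sum_sign_mul_selector_le ((lossPatterns l H w r).image vec) ?_ _ hcard
    (fun σ i => (if r < u (σ, Sum.inl i) then 1 else 0) - if r < u (σ, Sum.inr i) then 1 else 0) ?_
  · intro v hv i
    obtain ⟨P, -, rfl⟩ := Finset.mem_image.1 hv
    simp only [vec]
    split_ifs <;> simp
  · intro σ
    refine Finset.mem_image.2 ⟨lossPattern l w r (g σ), ?_, ?_⟩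
    · exact Finset.mem_filter.2 ⟨Finset.mem_univ _, g σ, hg σ, rfl⟩
    · ext i
      simp [vec, lossPattern, u]

theorem measurable_loss_comp {Ω : Type*} [MeasurableSpace Ω] {l : Pred → Fin 2 → ℝ}
    (hb : BoundedLoss l) (hc : ConvexLoss l) (he : ClassificationErrorLoss l) {f : Ω → Pred}
    {y : Ω → Fin 2} (hf : Measurable f) (hfs : ∀ ω, f ω ∈ stdSimplex ℝ (Fin 2))
    (hy : Measurable y) : Measurable fun ω => l (f ω) (y ω) := by
  obtain ⟨L, hL, -, hLl⟩ := exists_measurable_loss hb hc he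
  simp only [fun ω => hLl (f ω) (hfs ω) (y ω)]
  exact hL.comp (hf.prodMk hy)

theorem integrable_of_mem_Icc {Ω : Type*} [MeasurableSpace Ω] {μ : Measure Ω} [IsFiniteMeasure μ]
    {f : Ω → ℝ} {B : ℝ} (hf : Measurable f) (h : ∀ ω, 0 ≤ f ω ∧ f ω ≤ B) : Integrable f μ := by
  refine Integrable.of_bound hf.aestronglyMeasurable B (Filter.Eventually.of_forall fun ω => ?_)
  rw [Real.norm_eq_abs, abs_of_nonneg (h ω).1]
  exact (h ω).2

/-! ### Product measures -/

theorem integral_comp_of_measurePreserving {Ω Ω' : Type*} [MeasurableSpace Ω]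
    [MeasurableSpace Ω'] {μ : Measure Ω} {ν : Measure Ω'} {f : Ω → Ω'}
    (hf : MeasurePreserving f μ ν) {g : Ω' → ℝ} (hg : AEStronglyMeasurable g ν) :
    ∫ ω, g (f ω) ∂μ = ∫ ω, g ω ∂ν := by
  conv_rhs => rw [← hf.map_eq]
  exact (integral_map hf.measurable.aemeasurable (by rwa [hf.map_eq])).symm

theorem measurePreserving_pi_prod {ι : Type*} [Fintype ι] {α β : ι → Type*}
    [∀ i, MeasurableSpace (α i)] [∀ i, MeasurableSpace (β i)] (μ : ∀ i, Measure (α i))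
    (ν : ∀ i, Measure (β i)) [∀ i, IsProbabilityMeasure (μ i)]
    [∀ i, IsProbabilityMeasure (ν i)] :
    MeasurePreserving (fun w : ∀ i, α i × β i => ((fun i => (w i).1), (fun i => (w i).2)))
      (Measure.pi fun i => (μ i).prod (ν i)) ((Measure.pi μ).prod (Measure.pi ν)) := by
  have hm : Measurable fun w : ∀ i, α i × β i => ((fun i => (w i).1), (fun i => (w i).2)) := by
    fun_prop
  refine ⟨hm, (Measure.prod_eq_generateFrom generateFrom_pi generateFrom_pi isPiSystem_pi
    isPiSystem_pi ?_ ?_ ?_).symm⟩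
  · exact ⟨fun _ => Set.univ, fun _ => ⟨fun _ => Set.univ, fun _ _ => MeasurableSet.univ, by simp⟩,
      fun _ => measure_lt_top _ _, Set.iUnion_const _⟩
  · exact ⟨fun _ => Set.univ, fun _ => ⟨fun _ => Set.univ, fun _ _ => MeasurableSet.univ, by simp⟩,
      fun _ => measure_lt_top _ _, Set.iUnion_const _⟩
  · rintro _ ⟨s, hs, rfl⟩ _ ⟨t, ht, rfl⟩
    have hs' : ∀ i, MeasurableSet (s i) := fun i => hs i trivial
    have ht' : ∀ i, MeasurableSet (t i) := fun i => ht i trivial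
    rw [Measure.map_apply hm ((MeasurableSet.univ_pi hs').prod (MeasurableSet.univ_pi ht'))]
    have : (fun w : ∀ i, α i × β i => ((fun i => (w i).1), (fun i => (w i).2))) ⁻¹'
        (Set.univ.pi s ×ˢ Set.univ.pi t) = Set.univ.pi fun i => s i ×ˢ t i := by
      ext w; simp [forall_and]
    rw [this, Measure.pi_pi, Measure.pi_pi, Measure.pi_pi, ← Finset.prod_mul_distrib]
    simp only [Measure.prod_prod]

section

variable {X : Type*} [MeasurableSpace X] {M : ℕ} {k : Fin M → ℕ}

instance (D : Fin M → Measure (X × Fin 2)) [∀ j, IsProbabilityMeasure (D j)] :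
    IsProbabilityMeasure (sampleLaw k D) := by
  unfold sampleLaw; infer_instance

theorem measurePreserving_sample_point (D : Fin M → Measure (X × Fin 2))
    [∀ j, IsProbabilityMeasure (D j)] (j : Fin M) (i : Fin (k j)) :
    MeasurePreserving (fun S : Sample X k => S j i) (sampleLaw k D) (D j) :=
  (measurePreserving_eval (fun _ : Fin (k j) => D j) i).comp
    (measurePreserving_eval (fun j => Measure.pi fun _ : Fin (k j) => D j) j)

/-- Exchange the points of two samples at the positions where `σ` is false. -/
def swapSample (σ : (Σ j, Fin (k j)) → Bool) (q : Sample X k × Sample X k) :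
    Sample X k × Sample X k :=
  (fun j i => if σ ⟨j, i⟩ then q.1 j i else q.2 j i,
    fun j i => if σ ⟨j, i⟩ then q.2 j i else q.1 j i)

theorem measurePreserving_swapSample (D : Fin M → Measure (X × Fin 2))
    [∀ j, IsProbabilityMeasure (D j)] (σ : (Σ j, Fin (k j)) → Bool) :
    MeasurePreserving (swapSample σ) ((sampleLaw k D).prod (sampleLaw k D))
      ((sampleLaw k D).prod (sampleLaw k D)) := by
  let P : Measure ((j : Fin M) → Fin (k j) → (X × Fin 2) × (X × Fin 2)) :=
    Measure.pi fun j => Measure.pi fun _ => (D j).prod (D j)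
  have h1 : MeasurePreserving
      (fun w : (j : Fin M) → Fin (k j) → (X × Fin 2) × (X × Fin 2) =>
        (((fun j i => (w j i).1), (fun j i => (w j i).2)) : Sample X k × Sample X k)) P
      ((sampleLaw k D).prod (sampleLaw k D)) :=
    (measurePreserving_pi_prod (fun j => Measure.pi fun _ : Fin (k j) => D j)
      (fun j => Measure.pi fun _ : Fin (k j) => D j)).comp
      (measurePreserving_pi _ _ fun j =>
        measurePreserving_pi_prod (fun _ : Fin (k j) => D j) (fun _ : Fin (k j) => D j))
  have h2 : MeasurePreserving
      (fun (w : (j : Fin M) → Fin (k j) → (X × Fin 2) × (X × Fin 2)) j i =>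
        (if σ ⟨j, i⟩ then id else Prod.swap) (w j i)) P P := by
    refine measurePreserving_pi (fun j => Measure.pi fun _ => (D j).prod (D j))
      (fun j => Measure.pi fun _ => (D j).prod (D j))
      (f := fun j w i => (if σ ⟨j, i⟩ then id else Prod.swap) (w i)) fun j => ?_
    refine measurePreserving_pi (fun _ => (D j).prod (D j)) (fun _ => (D j).prod (D j))
      (f := fun i w => (if σ ⟨j, i⟩ then id else Prod.swap) w) fun i => ?_
    split_ifs
    · exact MeasurePreserving.id _
    · exact Measure.measurePreserving_swap
  have hm : Measurable (swapSample σ : Sample X k × Sample X k → _) := by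
    unfold swapSample
    refine Measurable.prodMk ?_ ?_ <;>
    · refine measurable_pi_lambda _ fun j => measurable_pi_lambda _ fun i => ?_
      split_ifs <;> fun_prop
  refine ⟨hm, ?_⟩
  conv_lhs => rw [← h1.map_eq]
  rw [Measure.map_map hm h1.measurable, ← (h1.comp h2).map_eq]
  congr 1
  ext w : 1
  refine Prod.ext ?_ ?_ <;>
  · funext j i
    by_cases h : σ ⟨j, i⟩ <;> simp [swapSample, h]

/-! ### Uniform convergence for empirical risk minimizers -/

/-- The sum of the losses over all points of a sample. -/
def sumLoss (l : Pred → Fin 2 → ℝ) (S : Sample X k) (h : X → Pred) : ℝ :=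
  ∑ j, ∑ i, l (h (S j i).1) (S j i).2

omit [MeasurableSpace X] in
theorem empRisk_eq (l : Pred → Fin 2 → ℝ) (S : Sample X k) (h : X → Pred) :
    empRisk l S h = sumLoss l S h / (∑ j, k j : ℕ) := by
  unfold empRisk sumLoss
  rw [Finset.sum_div]
  refine Finset.sum_congr rfl fun j _ => ?_
  rcases Nat.eq_zero_or_pos (k j) with h0 | h0
  · have : IsEmpty (Fin (k j)) := by rw [h0]; infer_instance
    simp
  · have : (k j : ℝ) ≠ 0 := by positivity
    field_simp

section loss

variable {l : Pred → Fin 2 → ℝ} (hb : BoundedLoss l) (hc : ConvexLoss l)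
  (he : ClassificationErrorLoss l)
include hb hc he

theorem risk_mem_Icc (D : Measure (X × Fin 2)) [IsProbabilityMeasure D] {h : X → Pred}
    (hs : ∀ x, h x ∈ stdSimplex ℝ (Fin 2)) : 0 ≤ risk l D h ∧ risk l D h ≤ 1 := by
  refine ⟨integral_nonneg fun z => (loss_mem_Icc hb hc he (hs _) _).1, ?_⟩
  have := integral_mono_of_nonneg (μ := D) (f := fun z => l (h z.1) z.2) (g := fun _ => 1)
    (Filter.Eventually.of_forall fun z => (loss_mem_Icc hb hc he (hs _) _).1)
    (integrable_const _) (Filter.Eventually.of_forall fun z => (loss_mem_Icc hb hc he (hs _) _).2)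
  rwa [integral_const, probReal_univ, one_smul] at this

theorem integrable_loss (D : Measure (X × Fin 2)) [IsProbabilityMeasure D] {h : X → Pred}
    (hm : Measurable h) (hs : ∀ x, h x ∈ stdSimplex ℝ (Fin 2)) :
    Integrable (fun z => l (h z.1) z.2) D :=
  integrable_of_mem_Icc (B := 1) (measurable_loss_comp hb hc he (hm.comp measurable_fst)
    (fun z => hs z.1) measurable_snd) fun _ => loss_mem_Icc hb hc he (hs _) _

theorem risk_mixture (n : Fin M → ℕ) (D : Fin M → Measure (X × Fin 2))
    [∀ j, IsProbabilityMeasure (D j)] {h : X → Pred} (hn : 0 < ∑ j, n j) (hm : Measurable h)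
    (hs : ∀ x, h x ∈ stdSimplex ℝ (Fin 2)) :
    risk l (mixture n D) h = ∑ j, (n j : ℝ) / (∑ i, n i : ℕ) * risk l (D j) h := by
  have hfin : ∀ j, ((n j : ℝ≥0∞) / ((∑ i, n i : ℕ) : ℝ≥0∞)) ≠ ∞ := fun j =>
    ENNReal.div_ne_top (ENNReal.natCast_ne_top _) (by exact_mod_cast hn.ne')
  unfold risk mixture
  rw [integral_finsetSum_measure fun j _ =>
    (integrable_loss hb hc he (D j) hm hs).smul_measure (hfin j)]
  refine Finset.sum_congr rfl fun j _ => ?_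
  rw [integral_smul_measure, smul_eq_mul, ENNReal.toReal_div, ENNReal.toReal_natCast,
    ENNReal.toReal_natCast]

theorem integral_sumLoss (D : Fin M → Measure (X × Fin 2)) [∀ j, IsProbabilityMeasure (D j)]
    {h : X → Pred} (hk : 0 < ∑ j, k j) (hm : Measurable h)
    (hs : ∀ x, h x ∈ stdSimplex ℝ (Fin 2)) :
    ∫ S : Sample X k, sumLoss l S h ∂sampleLaw k D =
      (∑ j, k j : ℕ) * risk l (mixture k D) h := by
  have hi := fun j => integrable_loss hb hc he (D j) hm hs
  have hmp := fun j i => measurePreserving_sample_point (k := k) D j i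
  have hi' : ∀ j i, Integrable (fun S : Sample X k => l (h (S j i).1) (S j i).2)
      (sampleLaw k D) := fun j i => (hmp j i).integrable_comp_of_integrable (hi j)
  have hval : ∀ j i, ∫ S : Sample X k, l (h (S j i).1) (S j i).2 ∂sampleLaw k D =
      risk l (D j) h := fun j i =>
    integral_comp_of_measurePreserving (hmp j i) (hi j).aestronglyMeasurable
  unfold sumLoss
  rw [integral_finsetSum _ fun j _ => integrable_finsetSum _ fun i _ => hi' j i]
  simp only [integral_finsetSum _ fun i _ => hi' _ i, hval]
  rw [risk_mixture hb hc he k D hk hm hs, Finset.mul_sum]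
  refine Finset.sum_congr rfl fun j _ => ?_
  have : ((∑ j, k j : ℕ) : ℝ) ≠ 0 := by positivity
  rw [Finset.sum_const, Finset.card_univ, Fintype.card_fin, nsmul_eq_mul]
  field_simp

omit [MeasurableSpace X] in
theorem sumLoss_mem_Icc (S : Sample X k) {h : X → Pred}
    (hs : ∀ x, h x ∈ stdSimplex ℝ (Fin 2)) :
    0 ≤ sumLoss l S h ∧ sumLoss l S h ≤ (∑ j, k j : ℕ) := by
  refine ⟨Finset.sum_nonneg fun j _ => Finset.sum_nonneg fun i _ =>
    (loss_mem_Icc hb hc he (hs _) _).1, ?_⟩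
  push_cast
  refine Finset.sum_le_sum fun j _ => ?_
  refine (Finset.sum_le_sum (g := fun _ => 1) fun i _ =>
    (loss_mem_Icc hb hc he (hs _) _).2).trans ?_
  simp

theorem measurable_sumLoss {Ω : Type*} [MeasurableSpace Ω] {π : Ω → Sample X k}
    (hπ : Measurable π) {G : Ω → X → Pred} (hG : Measurable fun q : Ω × X => G q.1 q.2)
    (hs : ∀ ω x, G ω x ∈ stdSimplex ℝ (Fin 2)) : Measurable fun ω => sumLoss l (π ω) (G ω) := by
  unfold sumLoss
  refine Finset.measurable_sum _ fun j _ => Finset.measurable_sum _ fun i _ => ?_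
  have h1 : Measurable fun ω => π ω j i :=
    (measurable_pi_apply i).comp ((measurable_pi_apply j).comp hπ)
  exact measurable_loss_comp hb hc he (hG.comp (measurable_id.prodMk h1.fst))
    (fun ω => hs _ _) h1.snd

/-- The expected gap between the errors of a learned hypothesis on a fresh sample and on its
training sample. -/
theorem integral_sumLoss_sub_le (D : Fin M → Measure (X × Fin 2))
    [∀ j, IsProbabilityMeasure (D j)] {H : Set (X → Pred)}
    (hHs : ∀ h ∈ H, ∀ x, h x ∈ stdSimplex ℝ (Fin 2)) {d : ℕ} (hd : HasVCDimension H d)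
    (hk : 0 < ∑ j, k j) (hdk : d ≤ 2 * ∑ j, k j) (A : Sample X k → X → Pred)
    (hA : ∀ S, A S ∈ H) (hAm : Measurable fun q : Sample X k × X => A q.1 q.2) :
    ∫ q : Sample X k × Sample X k, (sumLoss l q.2 (A q.1) - sumLoss l q.1 (A q.1))
      ∂(sampleLaw k D).prod (sampleLaw k D) ≤
      √(2 * (∑ j, k j : ℕ) * (d * (1 + Real.log ((2 * ∑ j, k j : ℕ) / d)))) := by
  set P := (sampleLaw k D).prod (sampleLaw k D) with hP
  set F : Sample X k × Sample X k → ℝ :=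
    fun q => sumLoss l q.2 (A q.1) - sumLoss l q.1 (A q.1) with hF
  have hAm' : Measurable fun q : (Sample X k × Sample X k) × X => A q.1.1 q.2 :=
    hAm.comp ((measurable_fst.comp measurable_fst).prodMk measurable_snd)
  have hFi : Integrable F P :=
    (integrable_of_mem_Icc (measurable_sumLoss hb hc he measurable_snd hAm' fun q => hHs _ (hA q.1)) fun q =>
      sumLoss_mem_Icc hb hc he _ (hHs _ (hA _))).sub
    (integrable_of_mem_Icc (measurable_sumLoss hb hc he measurable_fst hAm' fun q => hHs _ (hA q.1)) fun q =>
      sumLoss_mem_Icc hb hc he _ (hHs _ (hA _)))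
  have hcard : Fintype.card (Σ j, Fin (k j)) = ∑ j, k j := by simp
  set K : ℝ := 2 ^ Fintype.card (Σ j, Fin (k j)) with hK
  set B : ℝ := √(2 * (∑ j, k j : ℕ) * (d * (1 + Real.log ((2 * ∑ j, k j : ℕ) / d)))) with hB
  have hpt : ∀ q, ∑ σ : (Σ j, Fin (k j)) → Bool, F (swapSample σ q) ≤ K * B := by
    intro q
    have h := sum_sign_loss_sub_le hb hc he hHs hd (I := Σ j, Fin (k j)) (by omega) (by omega)
      (fun a => q.2 a.1 a.2) (fun a => q.1 a.1 a.2) (fun σ => A (swapSample σ q).1)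
      (fun σ => hA _)
    rw [hcard] at h
    rw [hK, hcard]
    refine le_of_eq_of_le (Finset.sum_congr rfl fun σ _ => ?_) h
    simp only [hF, sumLoss]
    rw [Fintype.sum_sigma, ← Finset.sum_sub_distrib]
    refine Finset.sum_congr rfl fun j _ => ?_
    rw [← Finset.sum_sub_distrib]
    refine Finset.sum_congr rfl fun i _ => ?_
    by_cases hσ : σ ⟨j, i⟩ <;> simp [swapSample, hσ, boolSign]
  have hinv : ∀ σ, ∫ q, F (swapSample σ q) ∂P = ∫ q, F q ∂P :=
    fun σ => integral_comp_of_measurePreserving (measurePreserving_swapSample D σ)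
      hFi.aestronglyMeasurable
  have hFs : ∀ σ, Integrable (fun q => F (swapSample σ q)) P := fun σ =>
    (measurePreserving_swapSample D σ).integrable_comp_of_integrable hFi
  have hsum : K * ∫ q, F q ∂P = ∫ q, ∑ σ : (Σ j, Fin (k j)) → Bool, F (swapSample σ q) ∂P := by
    rw [integral_finsetSum _ fun σ _ => hFs σ]
    simp [hinv, hK]
  have hle : ∫ q, ∑ σ : (Σ j, Fin (k j)) → Bool, F (swapSample σ q) ∂P ≤ ∫ _q, K * B ∂P :=
    integral_mono (integrable_finsetSum _ fun σ _ => hFs σ) (integrable_const _) hpt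
  rw [← hsum, integral_const, probReal_univ, one_smul] at hle
  exact le_of_mul_le_mul_left hle (by positivity)

/-- The excess risk of empirical risk minimization on the mixture of the clients. -/
theorem integral_risk_mixture_erm_le (D : Fin M → Measure (X × Fin 2))
    [∀ j, IsProbabilityMeasure (D j)] {H : Set (X → Pred)} (hHm : ∀ h ∈ H, Measurable h)
    (hHs : ∀ h ∈ H, ∀ x, h x ∈ stdSimplex ℝ (Fin 2)) {d : ℕ} (hd : HasVCDimension H d)
    (hk : 0 < ∑ j, k j) (hdk : d ≤ 2 * ∑ j, k j) (A : Sample X k → X → Pred)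
    (hA : IsERM l H A) (hAm : Measurable fun q : Sample X k × X => A q.1 q.2)
    {h : X → Pred} (hh : h ∈ H) :
    ∫ S : Sample X k, risk l (mixture k D) (A S) ∂sampleLaw k D ≤
      risk l (mixture k D) h + 2 * √((d : ℝ) / (2 * ∑ j, k j : ℕ)) *
        √(1 + Real.log ((2 * ∑ j, k j : ℕ) / d)) := by
  set N : ℕ := ∑ j, k j with hN
  have hNpos : (0 : ℝ) < N := by exact_mod_cast hk
  have hgap := integral_sumLoss_sub_le hb hc he D hHs hd hk hdk A (fun S => (hA S).1) hAm
  have hAm' : Measurable fun q : (Sample X k × Sample X k) × X => A q.1.1 q.2 :=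
    hAm.comp ((measurable_fst.comp measurable_fst).prodMk measurable_snd)
  have hA' : ∀ S, A S ∈ H := fun S => (hA S).1
  have hi2 : Integrable (fun q : Sample X k × Sample X k => sumLoss l q.2 (A q.1))
      ((sampleLaw k D).prod (sampleLaw k D)) := integrable_of_mem_Icc (measurable_sumLoss hb hc he measurable_snd hAm' fun q => hHs _ (hA' q.1))
    fun q => sumLoss_mem_Icc hb hc he _ (hHs _ (hA _).1)
  have hi1 : Integrable (fun q : Sample X k × Sample X k => sumLoss l q.1 (A q.1))
      ((sampleLaw k D).prod (sampleLaw k D)) := integrable_of_mem_Icc (measurable_sumLoss hb hc he measurable_fst hAm' fun q => hHs _ (hA' q.1))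
    fun q => sumLoss_mem_Icc hb hc he _ (hHs _ (hA _).1)
  have hih : Integrable (fun S : Sample X k => sumLoss l S h) (sampleLaw k D) :=
    integrable_of_mem_Icc (measurable_sumLoss hb hc he measurable_id
      ((hHm h hh).comp measurable_snd) fun _ => hHs h hh) fun S => sumLoss_mem_Icc hb hc he _ (hHs h hh)
  rw [integral_sub hi2 hi1, integral_prod _ hi2] at hgap
  have hAS : ∀ S, Measurable (A S) := fun S => hHm _ (hA S).1
  simp only [fun S => integral_sumLoss hb hc he D hk (hAS S) (hHs _ (hA S).1),
    integral_const_mul] at hgap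
  have hle : ∫ q : Sample X k × Sample X k, sumLoss l q.1 (A q.1)
      ∂(sampleLaw k D).prod (sampleLaw k D) ≤ N * risk l (mixture k D) h := by
    rw [← integral_sumLoss hb hc he D hk (hHm h hh) (hHs h hh)]
    refine (integral_mono hi1 (hih.comp_fst _) fun q => ?_).trans_eq ?_
    · have := (hA q.1).2 h hh
      rw [empRisk_eq, empRisk_eq] at this
      exact (div_le_div_iff_of_pos_right hNpos).1 this
    · rw [integral_prod _ (hih.comp_fst _)]
      simp
  have hroot : √(2 * (N : ℝ) * (d * (1 + Real.log ((2 * N : ℕ) / d)))) =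
      N * (2 * √((d : ℝ) / (2 * N : ℕ)) * √(1 + Real.log ((2 * N : ℕ) / d))) := by
    have : 2 * (N : ℝ) * (d * (1 + Real.log ((2 * N : ℕ) / d))) =
        (2 * N) ^ 2 * (((d : ℝ) / (2 * N : ℕ)) * (1 + Real.log ((2 * N : ℕ) / d))) := by
      push_cast; field_simp
    rw [this, Real.sqrt_mul (by positivity), Real.sqrt_sq (by positivity),
      Real.sqrt_mul (by positivity)]
    ring
  rw [hroot] at hgap
  refine le_of_mul_le_mul_left ?_ hNpos
  rw [mul_add]
  linarith

end loss

end

/-! ### Conditional label probabilities -/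

section

variable {X : Type*} [MeasurableSpace X]

theorem IsCondProb.ae_mem_Icc {D : Measure (X × Fin 2)} [IsProbabilityMeasure D] {η : X → ℝ}
    (h : IsCondProb D η) : ∀ᵐ x ∂D.fst, 0 ≤ η x ∧ η x ≤ 1 := by
  have hB : ∀ N : ℕ, MeasurableSet {x | |η x| ≤ N} := fun N =>
    measurableSet_le h.1.abs measurable_const
  have key : ∀ N : ℕ, ∀ᵐ x ∂D.fst, |η x| ≤ N → 0 ≤ η x ∧ η x ≤ 1 := by
    intro N
    refine (ae_restrict_iff' (hB N)).1 ?_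
    set μ := D.fst.restrict {x | |η x| ≤ N} with hμ
    have hi : Integrable η μ := by
      refine Integrable.of_bound h.1.aestronglyMeasurable N ?_
      exact (ae_restrict_iff' (hB N)).2 (Filter.Eventually.of_forall fun x hx => hx)
    have hset : ∀ s, MeasurableSet s → ∫ x in s, η x ∂μ =
        D.real ((s ∩ {x | |η x| ≤ N}) ×ˢ {1}) := by
      intro s hs
      rw [h.2 _ (hs.inter (hB N)), hμ, Measure.restrict_restrict hs]
    have h0 : 0 ≤ᵐ[μ] η := ae_nonneg_of_forall_setIntegral_nonneg hi fun s hs _ => by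
      rw [hset s hs]; exact measureReal_nonneg
    have h1 : 0 ≤ᵐ[μ] fun x => 1 - η x :=
      ae_nonneg_of_forall_setIntegral_nonneg ((integrable_const 1).sub hi) fun s hs _ => by
        rw [integral_sub (integrable_const _) hi.integrableOn, hset s hs, integral_const, smul_eq_mul,
          mul_one, measureReal_restrict_apply_univ, hμ, measureReal_restrict_apply hs,
          sub_nonneg, measureReal_def, measureReal_def, Measure.fst_apply (hs.inter (hB N))]
        refine ENNReal.toReal_mono (measure_ne_top _ _) (measure_mono ?_)
        rintro ⟨x, y⟩ hxy
        exact hxy.1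
    filter_upwards [h0, h1] with x hx0 hx1
    exact ⟨hx0, by simpa using hx1⟩
  filter_upwards [ae_all_iff.2 key] with x hx
  obtain ⟨N, hN⟩ := exists_nat_ge |η x|
  exact hx N hN

/-- A version of the conditional probability may be truncated to `[0, 1]`. -/
theorem IsCondProb.exists_clamp {D : Measure (X × Fin 2)} [IsProbabilityMeasure D] {η : X → ℝ}
    (h : IsCondProb D η) : ∃ ζ : X → ℝ, IsCondProb D ζ ∧ (∀ x, 0 ≤ ζ x ∧ ζ x ≤ 1) ∧
      bayesRule ζ = bayesRule η ∧ ∀ x x', |ζ x - ζ x'| ≤ |η x - η x'| := by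
  refine ⟨fun x => max 0 (min 1 (η x)), ⟨?_, fun B hB => ?_⟩, fun x =>
    ⟨le_max_left _ _, max_le zero_le_one (min_le_left _ _)⟩, ?_, fun x x' => ?_⟩
  · exact measurable_const.max (measurable_const.min h.1)
  · rw [h.2 B hB]
    refine setIntegral_congr_ae hB ?_
    filter_upwards [h.ae_mem_Icc] with x hx _
    rw [min_eq_right hx.2, max_eq_right hx.1]
  · funext x
    have : (1 / 2 < max 0 (min 1 (η x))) ↔ 1 / 2 < η x := by
      rw [lt_max_iff, lt_min_iff]
      norm_num
    simp only [bayesRule, this]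
  · calc |max 0 (min 1 (η x)) - max 0 (min 1 (η x'))| ≤ |min 1 (η x) - min 1 (η x')| := by
          have := abs_max_sub_max_le_max 0 (min 1 (η x)) 0 (min 1 (η x'))
          simpa using this
      _ ≤ |η x - η x'| := by
          have := abs_min_sub_min_le_max 1 (η x) 1 (η x')
          simpa using this

/-- The uniform distribution on `(0, 1]`. -/
noncomputable def unif : Measure ℝ := volume.restrict (Set.Ioc 0 1)

instance : IsProbabilityMeasure unif := ⟨by simp [unif]⟩

theorem unif_Iio {a : ℝ} (h1 : a ≤ 1) : unif (Set.Iio a) = ENNReal.ofReal a := by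
  have : Set.Iio a ∩ Set.Ioc 0 1 = Set.Ioo 0 a :=
    Set.ext fun r => ⟨fun h => ⟨h.2.1, h.1⟩, fun h => ⟨h.2, h.1, le_trans h.2.le h1⟩⟩
  rw [unif, Measure.restrict_apply measurableSet_Iio, this, Real.volume_Ioo, sub_zero]

theorem integral_unif_ite {a : ℝ} (h0 : 0 ≤ a) (h1 : a ≤ 1) (c d : ℝ) :
    ∫ u, (if u < a then c else d) ∂unif = a * c + (1 - a) * d := by
  have e : ∀ u : ℝ, (if u < a then c else d) = d + (c - d) * (Set.Iio a).indicator 1 u := by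
    intro u
    by_cases h : u < a <;> simp [h]
  have hi : Integrable ((Set.Iio a).indicator (1 : ℝ → ℝ)) unif :=
    (integrable_const (1 : ℝ)).indicator measurableSet_Iio
  simp only [e]
  rw [integral_add (integrable_const _) (hi.const_mul _), integral_const_mul,
    integral_indicator_one measurableSet_Iio, measureReal_def, unif_Iio h1,
    ENNReal.toReal_ofReal h0, integral_const, probReal_univ]
  simp; ring

/-- The label at `x` produced by the uniform variable `u`. -/
noncomputable def drawLabel (η : X → ℝ) (q : X × ℝ) : Fin 2 := if q.2 < η q.1 then 1 else 0

theorem measurable_drawLabel {η : X → ℝ} (hη : Measurable η) : Measurable (drawLabel η) :=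
  Measurable.ite (measurableSet_lt measurable_snd (hη.comp measurable_fst)) measurable_const
    measurable_const

theorem measurePreserving_drawLabel {D : Measure (X × Fin 2)} [IsProbabilityMeasure D]
    {η : X → ℝ} (h : IsCondProb D η) (h01 : ∀ x, 0 ≤ η x ∧ η x ≤ 1) :
    MeasurePreserving (fun q : X × ℝ => (q.1, drawLabel η q)) (D.fst.prod unif) D := by
  have hm : Measurable fun q : X × ℝ => (q.1, drawLabel η q) :=
    measurable_fst.prodMk (measurable_drawLabel h.1)
  refine ⟨hm, ?_⟩
  set P := (D.fst.prod unif).map fun q : X × ℝ => (q.1, drawLabel η q) with hP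
  have : IsProbabilityMeasure P := Measure.isProbabilityMeasure_map hm.aemeasurable
  have hone : ∀ s, MeasurableSet s → P (s ×ˢ {1}) = D (s ×ˢ {1}) := by
    intro s hs
    have hpre : (fun q : X × ℝ => (q.1, drawLabel η q)) ⁻¹' (s ×ˢ {1}) =
        {q | q.1 ∈ s ∧ q.2 < η q.1} := by
      ext q
      by_cases hq : q.2 < η q.1 <;> simp [drawLabel, hq]
    have hmp : MeasurableSet {q : X × ℝ | q.1 ∈ s ∧ q.2 < η q.1} :=
      (measurable_fst hs).inter (measurableSet_lt measurable_snd (h.1.comp measurable_fst))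
    rw [hP, Measure.map_apply hm (hs.prod (measurableSet_singleton _)), hpre,
      Measure.prod_apply hmp]
    have hsec : ∀ x, unif (Prod.mk x ⁻¹' {q : X × ℝ | q.1 ∈ s ∧ q.2 < η q.1}) =
        s.indicator (fun x => ENNReal.ofReal (η x)) x := by
      intro x
      by_cases hx : x ∈ s
      · rw [Set.indicator_of_mem hx, ← unif_Iio (h01 x).2]
        congr 1
        ext u; simp [hx]
      · simp [hx]
    simp only [hsec]
    rw [lintegral_indicator hs, ← ofReal_integral_eq_lintegral_ofReal
      (integrable_of_mem_Icc h.1 h01).integrableOn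
      (Filter.Eventually.of_forall fun x => (h01 x).1), ← h.2 s hs, measureReal_def,
      ENNReal.ofReal_toReal (measure_ne_top _ _)]
  have huniv : ∀ s, MeasurableSet s → P (s ×ˢ Set.univ) = D (s ×ˢ Set.univ) := by
    intro s hs
    have hpre : (fun q : X × ℝ => (q.1, drawLabel η q)) ⁻¹' (s ×ˢ Set.univ) =
        s ×ˢ Set.univ := by
      ext q; simp
    rw [hP, Measure.map_apply hm (hs.prod MeasurableSet.univ), hpre, Measure.prod_prod,
      measure_univ, mul_one, Measure.fst_apply hs]
    congr 1
    ext q; simp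
  have hsplit : ∀ (Q : Measure (X × Fin 2)) (s : Set X), MeasurableSet s →
      Q (s ×ˢ Set.univ) = Q (s ×ˢ {0}) + Q (s ×ˢ {1}) := by
    intro Q s hs
    rw [← measure_union _ (hs.prod (measurableSet_singleton _)), ← Set.prod_union]
    · congr 2
      ext y; fin_cases y <;> simp
    · rw [Set.disjoint_left]
      rintro ⟨x, y⟩ ⟨-, h0⟩ ⟨-, h1⟩
      simp at h0 h1
      omega
  refine Measure.ext_prod fun {s t} hs _ => ?_
  by_cases h0 : (0 : Fin 2) ∈ t <;> by_cases h1 : (1 : Fin 2) ∈ t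
  · have : t = Set.univ := by ext y; fin_cases y <;> simp [h0, h1]
    rw [this, huniv s hs]
  · have : t = {0} := by ext y; fin_cases y <;> simp [h0, h1]
    rw [this]
    have e := huniv s hs
    rw [hsplit P s hs, hsplit D s hs, hone s hs] at e
    exact (ENNReal.add_left_inj (measure_ne_top _ _)).1 e
  · have : t = {1} := by ext y; fin_cases y <;> simp [h0, h1]
    rw [this, hone s hs]
  · have : t = ∅ := by ext y; fin_cases y <;> simp [h0, h1]
    simp [this]

/-- The classification error of the predicted label `a` for the true label `b`. -/
noncomputable def zeroOne (a b : Fin 2) : ℝ := if a = b then 0 else 1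

theorem zeroOne_mem_Icc (a b : Fin 2) : 0 ≤ zeroOne a b ∧ zeroOne a b ≤ 1 := by
  unfold zeroOne; split_ifs <;> simp

theorem measurable_zeroOne {Ω : Type*} [MeasurableSpace Ω] {a b : Ω → Fin 2} (ha : Measurable a)
    (hb : Measurable b) : Measurable fun ω => zeroOne (a ω) (b ω) :=
  (Measurable.of_discrete (f := fun q : Fin 2 × Fin 2 => zeroOne q.1 q.2)).comp (ha.prodMk hb)

omit [MeasurableSpace X] in
theorem integral_zeroOne_drawLabel {η : X → ℝ} {x : X} (h : 0 ≤ η x ∧ η x ≤ 1) (a : Fin 2) :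
    ∫ u, zeroOne a (drawLabel η (x, u)) ∂unif = if a = 1 then 1 - η x else η x := by
  have e : ∀ u : ℝ, zeroOne a (drawLabel η (x, u)) =
      if u < η x then (if a = 1 then 0 else 1) else (if a = 1 then 1 else 0) := by
    intro u
    by_cases hu : u < η x <;> fin_cases a <;> simp [zeroOne, drawLabel, hu]
  simp only [e]
  rw [integral_unif_ite h.1 h.2]
  split_ifs <;> ring

/-- The Bayes risk. -/
theorem risk_bayesRule {l : Pred → Fin 2 → ℝ} (he : ClassificationErrorLoss l)
    {D : Measure (X × Fin 2)} [IsProbabilityMeasure D]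
    {η : X → ℝ} (h : IsCondProb D η) (h01 : ∀ x, 0 ≤ η x ∧ η x ≤ 1) :
    risk l D (bayesRule η) = ∫ x, min (η x) (1 - η x) ∂D.fst := by
  classical
  set b : X → Fin 2 := fun x => if 1 / 2 < η x then 1 else 0 with hb
  have hbm : Measurable b :=
    Measurable.ite (measurableSet_lt measurable_const h.1) measurable_const measurable_const
  have hm : Measurable fun z : X × Fin 2 => zeroOne (b z.1) z.2 :=
    measurable_zeroOne (hbm.comp measurable_fst) measurable_snd
  have hmp := measurePreserving_drawLabel h h01
  have e : risk l D (bayesRule η) = ∫ z : X × Fin 2, zeroOne (b z.1) z.2 ∂D := by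
    refine integral_congr_ae (Filter.Eventually.of_forall fun z => ?_)
    simp only [bayesRule, hb, zeroOne]
    exact he _ _
  rw [e, ← integral_comp_of_measurePreserving hmp hm.aestronglyMeasurable]
  refine (integral_prod _ (integrable_of_mem_Icc (B := 1) (hm.comp hmp.measurable) fun q =>
    zeroOne_mem_Icc _ _)).trans ?_
  refine integral_congr_ae (Filter.Eventually.of_forall fun x => ?_)
  refine (integral_zeroOne_drawLabel (h01 x) (b x)).trans ?_
  change _ = min (η x) (1 - η x)
  by_cases hx : 1 / 2 < η x
  · rw [if_pos (by simp [hb]; linarith), min_eq_right (by linarith)]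
  · rw [if_neg (by simp [hb]; linarith), min_eq_left (by linarith)]

end

/-! ### The distance to the nearest neighbour -/

/-- The cell of `t ∈ [0, 1]` in the partition of the unit interval into `T + 1` cells. -/
noncomputable def unitCell (T : ℕ) (t : ℝ) : Fin (T + 1) :=
  ⟨min ⌊((T : ℝ) + 1) * t⌋₊ T, by omega⟩

theorem measurable_unitCell (T : ℕ) : Measurable (unitCell T) := by
  have h : Measurable fun a : ℕ => (⟨min a T, by omega⟩ : Fin (T + 1)) := Measurable.of_discrete
  exact h.comp (Nat.measurable_floor.comp (measurable_const.mul measurable_id))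

theorem abs_sub_le_of_unitCell_eq {T : ℕ} {s t : ℝ} (hs : s ∈ Set.Icc (0 : ℝ) 1)
    (ht : t ∈ Set.Icc (0 : ℝ) 1) (h : unitCell T s = unitCell T t) :
    |s - t| ≤ 1 / ((T : ℝ) + 1) := by
  have hT : (0 : ℝ) < (T : ℝ) + 1 := by positivity
  have h' : min ⌊((T : ℝ) + 1) * s⌋₊ T = min ⌊((T : ℝ) + 1) * t⌋₊ T := congrArg Fin.val h
  have key : ∀ s ∈ Set.Icc (0 : ℝ) 1,
      ((min ⌊((T : ℝ) + 1) * s⌋₊ T : ℕ) : ℝ) ≤ ((T : ℝ) + 1) * s ∧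
      ((T : ℝ) + 1) * s ≤ ((min ⌊((T : ℝ) + 1) * s⌋₊ T : ℕ) : ℝ) + 1 := by
    intro s hs
    have h0 : 0 ≤ ((T : ℝ) + 1) * s := mul_nonneg hT.le hs.1
    rcases le_total ⌊((T : ℝ) + 1) * s⌋₊ T with hle | hle
    · rw [min_eq_left hle]
      exact ⟨Nat.floor_le h0, (Nat.lt_floor_add_one _).le⟩
    · rw [min_eq_right hle]
      exact ⟨le_trans (by exact_mod_cast hle) (Nat.floor_le h0), by nlinarith [hs.2]⟩
  have ks := key s hs
  have kt := key t ht
  rw [h'] at ks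
  have h1 : |((T : ℝ) + 1) * (s - t)| ≤ 1 := by
    rw [abs_le]; constructor <;> linarith
  rw [abs_mul, abs_of_pos hT] at h1
  rw [le_div_iff₀ hT, mul_comm]
  exact h1

theorem dist_le_of_coord {p : ℕ} {u v : Rep p} {δ : ℝ} (hδ : 0 ≤ δ) (h : ∀ i, |u i - v i| ≤ δ) :
    dist u v ≤ √p * δ := by
  rw [EuclideanSpace.dist_eq]
  calc √(∑ i, dist (u i) (v i) ^ 2) ≤ √(∑ _i : Fin p, δ ^ 2) := by
        refine Real.sqrt_le_sqrt (Finset.sum_le_sum fun i _ => ?_)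
        rw [Real.dist_eq]
        exact pow_le_pow_left₀ (abs_nonneg _) (h i) 2
    _ = √p * δ := by
        rw [Finset.sum_const, Finset.card_univ, Fintype.card_fin, nsmul_eq_mul,
          Real.sqrt_mul (by positivity), Real.sqrt_sq hδ]

theorem mul_one_sub_pow_le {t : ℝ} (h1 : t ≤ 1) {r : ℕ} (hr : 0 < r) :
    t * (1 - t) ^ r ≤ 1 / r := by
  have hr' : (0 : ℝ) < r := by exact_mod_cast hr
  have e1 : (1 - t) ^ r ≤ Real.exp (-(r * t)) := by
    have : 1 - t ≤ Real.exp (-t) := by linarith [Real.add_one_le_exp (-t)]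
    calc (1 - t) ^ r ≤ Real.exp (-t) ^ r := pow_le_pow_left₀ (by linarith) this r
      _ = _ := by rw [← Real.exp_nat_mul]; congr 1; ring
  rw [le_div_iff₀ hr']
  have e2 : r * t ≤ Real.exp (r * t) := by linarith [Real.add_one_le_exp (r * t)]
  calc t * (1 - t) ^ r * r = (r * t) * (1 - t) ^ r := by ring
    _ ≤ Real.exp (r * t) * Real.exp (-(r * t)) :=
      mul_le_mul e2 e1 (pow_nonneg (by linarith) _) (Real.exp_pos _).le
    _ = 1 := by rw [← Real.exp_add]; simp

section

variable {X : Type*} [MeasurableSpace X]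

theorem measurable_apply_index {Ω β : Type*} [MeasurableSpace Ω] [MeasurableSpace β] {r : ℕ}
    {w : Ω → Fin r → β} {e : Ω → Fin r} (hw : Measurable w) (he : Measurable e) :
    Measurable fun ω => w ω (e ω) :=
  (measurable_from_prod_countable_left (f := fun q : (Fin r → β) × Fin r => q.1 q.2)
    fun i => measurable_pi_apply i).comp (hw.prodMk he)

theorem measurable_nearest {p r : ℕ} {ν : (Fin r → Rep p) → Rep p → Fin r}
    (hν : IsNearestIndex ν) {f : X → Rep p} (hf : Measurable f) :
    Measurable fun q : (Fin r → X) × X => ν (fun i => f (q.1 i)) (f q.2) :=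
  hν.1.comp ((measurable_pi_lambda _ fun i =>
    hf.comp ((measurable_pi_apply i).comp measurable_fst)).prodMk (hf.comp measurable_snd))

/-- The probability that the cell of a fresh point contains no sample point. -/
theorem integral_missing_cell_le (μ : Measure X) [IsProbabilityMeasure μ] {C : Type*} [Fintype C]
    [MeasurableSpace C] [MeasurableSingletonClass C] {c : X → C} (hc : Measurable c) {r : ℕ}
    (hr : 0 < r) :
    ∫ x, (Measure.pi fun _ : Fin r => μ).real {xs | ∀ j, c (xs j) ≠ c x} ∂μ ≤
      Fintype.card C / r := by
  have e1 : ∀ a, (Measure.pi fun _ : Fin r => μ).real {xs | ∀ j, c (xs j) ≠ a} =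
      (1 - μ.real (c ⁻¹' {a})) ^ r := by
    intro a
    have : {xs : Fin r → X | ∀ j, c (xs j) ≠ a} = Set.univ.pi fun _ => (c ⁻¹' {a})ᶜ := by
      ext xs; simp
    rw [this, measureReal_def, Measure.pi_pi, Finset.prod_const, Finset.card_univ,
      Fintype.card_fin, ENNReal.toReal_pow, ← measureReal_def,
      probReal_compl_eq_one_sub (hc (measurableSet_singleton a))]
  have : IsProbabilityMeasure (μ.map c) := Measure.isProbabilityMeasure_map hc.aemeasurable
  have e2 : ∫ x, (Measure.pi fun _ : Fin r => μ).real {xs | ∀ j, c (xs j) ≠ c x} ∂μ =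
      ∫ a, (1 - μ.real (c ⁻¹' {a})) ^ r ∂μ.map c := by
    rw [integral_map hc.aemeasurable (StronglyMeasurable.of_discrete).aestronglyMeasurable]
    simp only [e1]
  rw [e2, integral_fintype .of_finite]
  calc ∑ a, (μ.map c).real {a} • (1 - μ.real (c ⁻¹' {a})) ^ r
      ≤ ∑ _a : C, 1 / (r : ℝ) := by
        refine Finset.sum_le_sum fun a _ => ?_
        rw [map_measureReal_apply hc (measurableSet_singleton a), smul_eq_mul]
        exact mul_one_sub_pow_le measureReal_le_one hr
    _ = _ := by rw [Finset.sum_const, Finset.card_univ, nsmul_eq_mul]; ring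

theorem integral_dist_nearest_le (μ : Measure X) [IsProbabilityMeasure μ] {p r : ℕ} (hr : 0 < r)
    {ν : (Fin r → Rep p) → Rep p → Fin r} (hν : IsNearestIndex ν) {f : X → Rep p}
    (hf : Measurable f) (hf01 : ∀ x i, f x i ∈ Set.Icc (0 : ℝ) 1) (T : ℕ) :
    ∫ q : (Fin r → X) × X, dist (f q.2) (f (q.1 (ν (fun i => f (q.1 i)) (f q.2))))
        ∂(Measure.pi fun _ : Fin r => μ).prod μ ≤
      √p * (1 / ((T : ℝ) + 1) + ((T : ℝ) + 1) ^ p / r) := by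
  classical
  set P := (Measure.pi fun _ : Fin r => μ).prod μ with hP
  let c : X → Fin p → Fin (T + 1) := fun x i => unitCell T (f x i)
  have hcm : Measurable c := measurable_pi_lambda _ fun i =>
    (measurable_unitCell T).comp ((measurable_pi_apply i).comp
      ((PiLp.continuous_ofLp 2 _).measurable.comp hf))
  let E : Set ((Fin r → X) × X) := {q | ∀ j, c (q.1 j) ≠ c q.2}
  have hE : MeasurableSet E := by
    have : E = ⋂ j, {q : (Fin r → X) × X | c (q.1 j) = c q.2}ᶜ := by ext q; simp [E]
    rw [this]
    refine MeasurableSet.iInter fun j => (measurableSet_eq_fun ?_ ?_).compl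
    · exact hcm.comp ((measurable_pi_apply j).comp measurable_fst)
    · exact hcm.comp measurable_snd
  have hpt : ∀ q : (Fin r → X) × X, dist (f q.2) (f (q.1 (ν (fun i => f (q.1 i)) (f q.2)))) ≤
      √p * (1 / ((T : ℝ) + 1)) + √p * E.indicator 1 q := by
    intro q
    by_cases hq : q ∈ E
    · rw [Set.indicator_of_mem hq]
      have : dist (f q.2) (f (q.1 (ν (fun i => f (q.1 i)) (f q.2)))) ≤ √p * 1 := by
        refine dist_le_of_coord zero_le_one fun i => ?_
        have h1 := hf01 q.2 i
        have h2 := hf01 (q.1 (ν (fun i => f (q.1 i)) (f q.2))) i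
        rw [abs_le]
        constructor <;> linarith [h1.1, h1.2, h2.1, h2.2]
      have h0 : 0 ≤ √(p : ℝ) * (1 / ((T : ℝ) + 1)) := by positivity
      simp only [Pi.one_apply]
      linarith
    · rw [Set.indicator_of_notMem hq, mul_zero, add_zero]
      simp only [E, Set.mem_ofPred_eq, not_forall, not_not] at hq
      obtain ⟨j, hj⟩ := hq
      refine (hν.2 (fun i => f (q.1 i)) (f q.2) j).trans ?_
      refine dist_le_of_coord (by positivity) fun i => ?_
      exact abs_sub_le_of_unitCell_eq (hf01 _ i) (hf01 _ i) (congrFun hj i).symm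
  have hiE : Integrable (E.indicator (1 : (Fin r → X) × X → ℝ)) P :=
    (integrable_const (1 : ℝ)).indicator hE
  refine (integral_mono_of_nonneg (Filter.Eventually.of_forall fun q => dist_nonneg)
    ((integrable_const _).add (hiE.const_mul _)) (Filter.Eventually.of_forall hpt)).trans ?_
  simp only [Pi.add_apply]
  rw [integral_add (integrable_const _) (hiE.const_mul _), integral_const, probReal_univ, one_smul,
    integral_const_mul, mul_add]
  gcongr
  rw [hP, integral_prod_symm _ hiE]
  have hin : ∀ x, ∫ xs, E.indicator (1 : (Fin r → X) × X → ℝ) (xs, x)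
      ∂(Measure.pi fun _ : Fin r => μ) =
      (Measure.pi fun _ : Fin r => μ).real {xs | ∀ j, c (xs j) ≠ c x} := by
    intro x
    rw [← integral_indicator_one]
    · rfl
    · exact measurable_prodMk_right hE
  simp only [hin]
  refine (integral_missing_cell_le μ hcm hr).trans_eq ?_
  simp

theorem exists_grid_size (p : ℕ) {r n : ℕ} (hr : 0 < r) (hn : n = 2 * r) :
    ∃ T : ℕ, 1 / ((T : ℝ) + 1) + ((T : ℝ) + 1) ^ p / r ≤
      6 / (n : ℝ) ^ (1 / ((p : ℝ) + 1)) := by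
  have hr' : (1 : ℝ) ≤ r := by exact_mod_cast hr
  set a : ℝ := 1 / ((p : ℝ) + 1) with ha
  have ha0 : 0 ≤ a := by positivity
  have ha1 : a ≤ 1 := by
    rw [ha, div_le_one (by positivity)]
    linarith [Nat.cast_nonneg (α := ℝ) p]
  set s : ℝ := (r : ℝ) ^ a with hs
  have hs1 : 1 ≤ s := Real.one_le_rpow hr' ha0
  have hsp : s ^ (p + 1) = r := by
    rw [hs, ← Real.rpow_natCast, ← Real.rpow_mul (by linarith), ha]
    push_cast
    rw [one_div_mul_cancel (by positivity), Real.rpow_one]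
  have hfl : 1 ≤ ⌊s⌋₊ := Nat.le_floor (by simpa using hs1)
  have hcast : ((⌊s⌋₊ - 1 : ℕ) : ℝ) + 1 = ⌊s⌋₊ := by
    rw [Nat.cast_sub hfl]; simp
  refine ⟨⌊s⌋₊ - 1, ?_⟩
  rw [hcast]
  have h1 : (1 : ℝ) ≤ ⌊s⌋₊ := by exact_mod_cast hfl
  have h2 : (⌊s⌋₊ : ℝ) ≤ s := Nat.floor_le (by linarith)
  have h3 : s < ⌊s⌋₊ + 1 := Nat.lt_floor_add_one s
  have hA : 1 / (⌊s⌋₊ : ℝ) ≤ 2 / s := by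
    rw [div_le_div_iff₀ (by linarith) (by linarith)]; linarith
  have hB : (⌊s⌋₊ : ℝ) ^ p / r ≤ 1 / s := by
    rw [div_le_div_iff₀ (by linarith) (by linarith), one_mul]
    calc (⌊s⌋₊ : ℝ) ^ p * s ≤ s ^ p * s := by gcongr
      _ = r := by rw [← pow_succ, hsp]
  have hC : (n : ℝ) ^ a ≤ 2 * s := by
    rw [hn]
    push_cast
    rw [Real.mul_rpow (by norm_num) (by linarith)]
    have : (2 : ℝ) ^ a ≤ 2 := by
      calc (2 : ℝ) ^ a ≤ 2 ^ (1 : ℝ) := Real.rpow_le_rpow_of_exponent_le (by norm_num) ha1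
        _ = 2 := Real.rpow_one 2
    gcongr
  have hn0 : 0 < (n : ℝ) ^ a := Real.rpow_pos_of_pos (by rw [hn]; push_cast; linarith) _
  have hD : 3 / s ≤ 6 / (n : ℝ) ^ a := by
    rw [div_le_div_iff₀ (by linarith) hn0]; linarith
  have : 2 / s + 1 / s = 3 / s := by ring
  linarith

end

/-! ### The risk of the nearest-neighbour rule -/

section

variable {X : Type*} [MeasurableSpace X]

theorem oneNN_disagreement_le {a b : ℝ} (hb0 : 0 ≤ b) (hb1 : b ≤ 1) :
    a * (1 - b) + (1 - a) * b ≤ 2 * min b (1 - b) + |b - a| := by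
  have h1 := le_abs_self (b - a)
  have h2 := neg_abs_le (b - a)
  rcases le_total b (1 - b) with h | h
  · rw [min_eq_left h]; nlinarith
  · rw [min_eq_right h]; nlinarith

theorem integral_risk_oneNN_le {l : Pred → Fin 2 → ℝ} (he : ClassificationErrorLoss l)
    {D : Measure (X × Fin 2)} [IsProbabilityMeasure D] {η : X → ℝ} (h : IsCondProb D η)
    (h01 : ∀ x, 0 ≤ η x ∧ η x ≤ 1) {p r : ℕ} {ν : (Fin r → Rep p) → Rep p → Fin r}
    (hν : IsNearestIndex ν) {f : X → Rep p} (hf : Measurable f)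
    (hf01 : ∀ x i, f x i ∈ Set.Icc (0 : ℝ) 1) {K : ℝ}
    (hK : ∀ x x', |η x - η x'| ≤ K * dist (f x) (f x')) :
    ∫ T, risk l D (oneNN ν f T) ∂(Measure.pi fun _ : Fin r => D) ≤
      2 * risk l D (bayesRule η) +
        K * ∫ q : (Fin r → X) × X, dist (f q.2) (f (q.1 (ν (fun i => f (q.1 i)) (f q.2))))
          ∂(Measure.pi fun _ : Fin r => D.fst).prod D.fst := by
  set μ := D.fst with hμ
  let e : (Fin r → X) × X → Fin r := fun q => ν (fun i => f (q.1 i)) (f q.2)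
  have hem : Measurable e := measurable_nearest hν hf
  have hlab := measurable_drawLabel h.1
  have hB := measurePreserving_drawLabel h h01
  -- the error on a sample `T` and a fresh point `z`
  let g : (Fin r → X × Fin 2) × (X × Fin 2) → ℝ := fun q =>
    zeroOne (q.1 (e (fun i => (q.1 i).1, q.2.1))).2 q.2.2
  have hgm : Measurable g := by
    have h1 : Measurable fun q : (Fin r → X × Fin 2) × (X × Fin 2) =>
        q.1 (e (fun i => (q.1 i).1, q.2.1)) :=
      measurable_apply_index measurable_fst (hem.comp (by fun_prop))
    exact measurable_zeroOne h1.snd (measurable_snd.comp measurable_snd)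
  have s1 : ∫ T, risk l D (oneNN ν f T) ∂(Measure.pi fun _ : Fin r => D) =
      ∫ q, g q ∂(Measure.pi fun _ : Fin r => D).prod D := by
    rw [integral_prod _ (integrable_of_mem_Icc (B := 1) hgm fun q => zeroOne_mem_Icc _ _)]
    simp only [risk, oneNN, he _ _]
    rfl
  -- the same error in terms of points and uniform variables
  let g' : ((Fin r → X) × (Fin r → ℝ)) × (X × ℝ) → ℝ := fun q =>
    zeroOne (drawLabel η (q.1.1 (e (q.1.1, q.2.1)), q.1.2 (e (q.1.1, q.2.1)))) (drawLabel η q.2)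
  have hidx : Measurable fun q : ((Fin r → X) × (Fin r → ℝ)) × X =>
      (q.1.1 (e (q.1.1, q.2)), q.1.2 (e (q.1.1, q.2))) :=
    (measurable_apply_index (by fun_prop) (hem.comp (by fun_prop))).prodMk
      (measurable_apply_index (by fun_prop) (hem.comp (by fun_prop)))
  have hgm' : Measurable g' :=
    measurable_zeroOne (hlab.comp (hidx.comp (by fun_prop :
      Measurable fun q : ((Fin r → X) × (Fin r → ℝ)) × (X × ℝ) => (q.1, q.2.1))))
      (hlab.comp measurable_snd)
  have s2 : ∫ q, g q ∂(Measure.pi fun _ : Fin r => D).prod D =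
      ∫ q, g' q ∂((Measure.pi fun _ : Fin r => μ).prod (Measure.pi fun _ : Fin r => unif)).prod
        (μ.prod unif) := by
    have m1 := (measurePreserving_pi (fun _ : Fin r => μ.prod unif) (fun _ => D)
      (fun _ => hB)).prod hB
    have m2 := (measurePreserving_pi_prod (fun _ : Fin r => μ) (fun _ => unif)).prod
      (MeasurePreserving.id (μ.prod unif))
    rw [← integral_comp_of_measurePreserving m1 hgm.aestronglyMeasurable,
      ← integral_comp_of_measurePreserving m2 hgm'.aestronglyMeasurable]
    rfl
  -- integrate out the label of the fresh point
  let g₂ : ((Fin r → X) × (Fin r → ℝ)) × X → ℝ := fun q =>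
    if drawLabel η (q.1.1 (e (q.1.1, q.2)), q.1.2 (e (q.1.1, q.2))) = 1 then 1 - η q.2 else η q.2
  have hgm₂ : Measurable g₂ :=
    Measurable.ite (measurableSet_eq_fun (hlab.comp hidx) measurable_const)
      (measurable_const.sub (h.1.comp measurable_snd)) (h.1.comp measurable_snd)
  have hg₂01 : ∀ q, 0 ≤ g₂ q ∧ g₂ q ≤ 1 := by
    intro q
    have := h01 q.2
    simp only [g₂]
    split_ifs <;> constructor <;> linarith
  have s3 : ∫ q, g' q ∂((Measure.pi fun _ : Fin r => μ).prod
      (Measure.pi fun _ : Fin r => unif)).prod (μ.prod unif) =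
      ∫ q, g₂ q ∂((Measure.pi fun _ : Fin r => μ).prod (Measure.pi fun _ : Fin r => unif)).prod
        μ := by
    rw [integral_prod _ (integrable_of_mem_Icc (B := 1) hgm' fun q => zeroOne_mem_Icc _ _),
      integral_prod _ (integrable_of_mem_Icc (B := 1) hgm₂ hg₂01)]
    refine integral_congr_ae (Filter.Eventually.of_forall fun a => ?_)
    simp only
    refine (integral_prod _ (integrable_of_mem_Icc (B := 1) (hgm'.comp measurable_prodMk_left)
      fun q => zeroOne_mem_Icc _ _)).trans ?_
    refine integral_congr_ae (Filter.Eventually.of_forall fun x => ?_)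
    exact integral_zeroOne_drawLabel (h01 x)
      (drawLabel η (a.1 (e (a.1, x)), a.2 (e (a.1, x))))
  -- integrate out the label of the nearest sample point
  let g₃ : (Fin r → X) × X → ℝ := fun q =>
    η (q.1 (e q)) * (1 - η q.2) + (1 - η (q.1 (e q))) * η q.2
  have hnear : Measurable fun q : (Fin r → X) × X => q.1 (e q) :=
    measurable_apply_index measurable_fst hem
  have hgm₃ : Measurable g₃ := by
    have h1 := h.1.comp hnear
    have h2 : Measurable fun q : (Fin r → X) × X => η q.2 := h.1.comp measurable_snd
    exact (h1.mul (measurable_const.sub h2)).add ((measurable_const.sub h1).mul h2)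
  have hg₃01 : ∀ q, 0 ≤ g₃ q ∧ g₃ q ≤ 1 := by
    intro q
    obtain ⟨a0, a1⟩ := h01 (q.1 (e q))
    obtain ⟨b0, b1⟩ := h01 q.2
    simp only [g₃]
    constructor <;> nlinarith
  have s4 : ∫ q, g₂ q ∂((Measure.pi fun _ : Fin r => μ).prod
      (Measure.pi fun _ : Fin r => unif)).prod μ =
      ∫ q, g₃ q ∂(Measure.pi fun _ : Fin r => μ).prod μ := by
    rw [integral_prod_symm _ (integrable_of_mem_Icc (B := 1) hgm₂ hg₂01),
      integral_prod_symm _ (integrable_of_mem_Icc (B := 1) hgm₃ hg₃01)]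
    refine integral_congr_ae (Filter.Eventually.of_forall fun x => ?_)
    simp only
    refine (integral_prod _ (integrable_of_mem_Icc (B := 1) (hgm₂.comp measurable_prodMk_right)
      fun q => hg₂01 _)).trans ?_
    refine integral_congr_ae (Filter.Eventually.of_forall fun xs => ?_)
    have hmp := measurePreserving_eval (fun _ : Fin r => unif) (e (xs, x))
    have hif : Measurable fun u : ℝ => if u < η (xs (e (xs, x))) then 1 - η x else η x :=
      Measurable.ite measurableSet_Iio measurable_const measurable_const
    refine Eq.trans ?_ (integral_unif_ite (h01 (xs (e (xs, x)))).1 (h01 _).2 (1 - η x) (η x))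
    rw [← integral_comp_of_measurePreserving hmp hif.aestronglyMeasurable]
    refine integral_congr_ae (Filter.Eventually.of_forall fun us => ?_)
    by_cases hu : us (e (xs, x)) < η (xs (e (xs, x))) <;> simp [g₂, drawLabel, hu]
  rw [s1, s2, s3, s4, risk_bayesRule he h h01]
  have hdm : Measurable fun q : (Fin r → X) × X => dist (f q.2) (f (q.1 (e q))) :=
    (hf.comp measurable_snd).dist (hf.comp hnear)
  have hdi : Integrable (fun q : (Fin r → X) × X => dist (f q.2) (f (q.1 (e q))))
      ((Measure.pi fun _ : Fin r => μ).prod μ) :=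
    integrable_of_mem_Icc hdm fun q => ⟨dist_nonneg, dist_le_of_coord zero_le_one fun i => by
      have h1 := hf01 q.2 i
      have h2 := hf01 (q.1 (e q)) i
      rw [abs_le]
      constructor <;> linarith [h1.1, h1.2, h2.1, h2.2]⟩
  have hmi : Integrable (fun x => min (η x) (1 - η x)) μ :=
    integrable_of_mem_Icc (B := 1) (h.1.min (measurable_const.sub h.1)) fun x =>
      ⟨le_min (h01 x).1 (by linarith [(h01 x).2]), (min_le_left _ _).trans (h01 x).2⟩
  have hmi' : Integrable (fun q : (Fin r → X) × X => min (η q.2) (1 - η q.2))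
      ((Measure.pi fun _ : Fin r => μ).prod μ) := hmi.comp_snd _
  have hrhs : 2 * ∫ x, min (η x) (1 - η x) ∂μ + K * ∫ q : (Fin r → X) × X,
      dist (f q.2) (f (q.1 (e q))) ∂(Measure.pi fun _ : Fin r => μ).prod μ =
      ∫ q : (Fin r → X) × X, (2 * min (η q.2) (1 - η q.2) + K * dist (f q.2) (f (q.1 (e q))))
        ∂(Measure.pi fun _ : Fin r => μ).prod μ := by
    rw [integral_add (hmi'.const_mul 2) (hdi.const_mul K), integral_const_mul, integral_const_mul]
    congr 2
    exact (integral_comp_of_measurePreserving (measurePreserving_snd (μ := Measure.pi fun _ : Fin r => μ))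
      hmi.aestronglyMeasurable).symm
  refine le_trans ?_ hrhs.ge
  refine integral_mono_of_nonneg (Filter.Eventually.of_forall fun q => (hg₃01 q).1)
    ((hmi'.const_mul 2).add (hdi.const_mul K)) (Filter.Eventually.of_forall fun q => ?_)
  exact (oneNN_disagreement_le (h01 q.2).1 (h01 q.2).2).trans (by
    have := hK q.2 (q.1 (e q))
    simp only
    linarith)

end

/-! ### The personalized model -/

section

variable {X : Type*} [MeasurableSpace X] {M : ℕ}

theorem mixture_two_mul {n k : Fin M → ℕ} (h : ∀ j, n j = 2 * k j)
    (D : Fin M → Measure (X × Fin 2)) : mixture n D = mixture k D := by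
  unfold mixture
  refine Finset.sum_congr rfl fun j _ => ?_
  congr 1
  simp only [h, ← Finset.mul_sum]
  push_cast
  exact ENNReal.mul_div_mul_left _ _ (by simp) (by simp)

theorem isProbabilityMeasure_mixture {k : Fin M → ℕ} (hk : 0 < ∑ j, k j)
    (D : Fin M → Measure (X × Fin 2)) [∀ j, IsProbabilityMeasure (D j)] :
    IsProbabilityMeasure (mixture k D) := by
  constructor
  unfold mixture
  simp only [Measure.finsetSum_apply, Measure.smul_apply, measure_univ, smul_eq_mul, mul_one,
    ENNReal.div_eq_inv_mul]
  rw [← Finset.mul_sum, ← Nat.cast_sum]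
  exact ENNReal.inv_mul_cancel (by exact_mod_cast hk.ne') (ENNReal.natCast_ne_top _)

variable {l : Pred → Fin 2 → ℝ} (hb : BoundedLoss l) (hc : ConvexLoss l)
  (he : ClassificationErrorLoss l)
include hb hc he

theorem abs_risk_sub_le_disc {H : Set (X → Pred)}
    (hHs : ∀ h ∈ H, ∀ x, h x ∈ stdSimplex ℝ (Fin 2)) (D₁ D₂ : Measure (X × Fin 2))
    [IsProbabilityMeasure D₁] [IsProbabilityMeasure D₂] {h : X → Pred} (hh : h ∈ H) :
    |risk l D₁ h - risk l D₂ h| ≤ disc l H D₁ D₂ := by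
  refine le_ciSup (f := fun h : H => |risk l D₁ h - risk l D₂ h|) ⟨1, ?_⟩ ⟨h, hh⟩
  rintro _ ⟨g, rfl⟩
  have h1 := risk_mem_Icc hb hc he D₁ (hHs g g.2)
  have h2 := risk_mem_Icc hb hc he D₂ (hHs g g.2)
  simp only [abs_le]
  constructor <;> linarith [h1.1, h1.2, h2.1, h2.2]

theorem measurable_risk {Ω : Type*} [MeasurableSpace Ω] (D : Measure (X × Fin 2))
    [IsProbabilityMeasure D] {G : Ω → X → Pred} (hG : Measurable fun q : Ω × X => G q.1 q.2)
    (hs : ∀ ω x, G ω x ∈ stdSimplex ℝ (Fin 2)) : Measurable fun ω => risk l D (G ω) := by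
  have : Measurable fun q : Ω × (X × Fin 2) => l (G q.1 q.2.1) q.2.2 :=
    measurable_loss_comp hb hc he (hG.comp (measurable_fst.prodMk measurable_snd.fst))
      (fun _ => hs _ _) measurable_snd.snd
  exact (StronglyMeasurable.integral_prod_right (f := fun ω (z : X × Fin 2) => l (G ω z.1) z.2)
    this.stronglyMeasurable).measurable

/-- The expected risk of the global model under the distribution of one client. -/
theorem integral_risk_erm_le {k : Fin M → ℕ} (D : Fin M → Measure (X × Fin 2))
    [∀ j, IsProbabilityMeasure (D j)] {H : Set (X → Pred)} (hHm : ∀ h ∈ H, Measurable h)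
    (hHs : ∀ h ∈ H, ∀ x, h x ∈ stdSimplex ℝ (Fin 2)) {d : ℕ} (hd : HasVCDimension H d)
    (hk : 0 < ∑ j, k j) (hdk : d ≤ 2 * ∑ j, k j) (A : Sample X k → X → Pred)
    (hA : IsERM l H A) (hAm : Measurable fun q : Sample X k × X => A q.1 q.2)
    {h : X → Pred} (hh : h ∈ H) (m : Fin M) :
    ∫ S : Sample X k, risk l (D m) (A S) ∂sampleLaw k D ≤
      risk l (D m) h + 2 * disc l H (mixture k D) (D m) +
        2 * √((d : ℝ) / (2 * ∑ j, k j : ℕ)) * √(1 + Real.log ((2 * ∑ j, k j : ℕ) / d)) := by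
  have := isProbabilityMeasure_mixture hk D
  have herm := integral_risk_mixture_erm_le hb hc he D hHm hHs hd hk hdk A hA hAm hh
  have hint : ∀ (Q : Measure (X × Fin 2)) [IsProbabilityMeasure Q],
      Integrable (fun S => risk l Q (A S)) (sampleLaw k D) := fun Q _ =>
    integrable_of_mem_Icc (measurable_risk hb hc he Q hAm fun S => hHs _ (hA S).1) fun S =>
      risk_mem_Icc hb hc he Q (hHs _ (hA S).1)
  have h1 : ∫ S : Sample X k, risk l (D m) (A S) ∂sampleLaw k D ≤
      ∫ S : Sample X k, (risk l (mixture k D) (A S) + disc l H (mixture k D) (D m))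
        ∂sampleLaw k D := by
    refine integral_mono (hint _) ((hint _).add (integrable_const _)) fun S => ?_
    have := (abs_le.1 (abs_risk_sub_le_disc hb hc he hHs (mixture k D) (D m) (hA S).1)).1
    simp only
    linarith
  rw [integral_add (hint _) (integrable_const _), integral_const, probReal_univ, one_smul] at h1
  have h2 := (abs_le.1 (abs_risk_sub_le_disc hb hc he hHs (mixture k D) (D m) hh)).2
  linarith

/-- Convexity of the risk. -/
theorem risk_combination_le (D : Measure (X × Fin 2)) [IsProbabilityMeasure D] {f g : X → Pred}
    {lam : ℝ} (h0 : 0 ≤ lam) (h1 : lam ≤ 1) (hf : Measurable f)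
    (hfs : ∀ x, f x ∈ stdSimplex ℝ (Fin 2)) (hg : Measurable g)
    (hgs : ∀ x, g x ∈ stdSimplex ℝ (Fin 2)) :
    risk l D (fun x => lam • f x + (1 - lam) • g x) ≤
      lam * risk l D f + (1 - lam) * risk l D g := by
  have hif := integrable_loss hb hc he D hf hfs
  have hig := integrable_loss hb hc he D hg hgs
  unfold risk
  rw [← integral_const_mul, ← integral_const_mul,
    ← integral_add (hif.const_mul _) (hig.const_mul _)]
  have h2 : 0 ≤ 1 - lam := by linarith
  refine integral_mono_of_nonneg (Filter.Eventually.of_forall fun z => ?_)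
    ((hif.const_mul _).add (hig.const_mul _)) (Filter.Eventually.of_forall fun z => ?_)
  · exact (loss_mem_Icc hb hc he
      (convex_stdSimplex ℝ (Fin 2) (hfs _) (hgs _) h0 h2 (by ring)) _).1
  · exact (hc z.2).2 (hfs z.1) (hgs z.1) h0 h2 (by ring)

end

theorem measurable_oneNN {X Ω : Type*} [MeasurableSpace X] [MeasurableSpace Ω] {p r : ℕ}
    {ν : (Fin r → Rep p) → Rep p → Fin r} (hν : IsNearestIndex ν) {f : Ω → X → Rep p}
    (hf : Measurable fun q : Ω × X => f q.1 q.2) {T : Ω → Fin r → X × Fin 2}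
    (hT : Measurable T) : Measurable fun q : Ω × X => oneNN ν (f q.1) (T q.1) q.2 := by
  have hT' : Measurable fun q : Ω × X => T q.1 := hT.comp measurable_fst
  have hidx : Measurable fun q : Ω × X =>
      ν (fun i => f q.1 (T q.1 i).1) (f q.1 q.2) :=
    hν.1.comp ((measurable_pi_lambda _ fun i => hf.comp
      (measurable_fst.prodMk ((measurable_pi_apply i).comp hT').fst)).prodMk hf)
  exact (Measurable.of_discrete (f := vertex)).comp (measurable_apply_index hT' hidx).snd

end KNNPer

open KNNPer in
theorem mainTheorem1 (γ₁ γ₂ : ℝ) :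
    -- the constants depend only on the two constants of the Lipschitz-type condition
    ∃ c₁ c₂ c₃ c₄ c₅ : ℝ,
      ∀ {X : Type*} [MeasurableSpace X]
        -- the clients, their distributions and sample sizes; the two halves have equal size
        (M : ℕ) (D : Fin M → Measure (X × Fin 2)) (_ : ∀ j, IsProbabilityMeasure (D j))
        (n k : Fin M → ℕ) (_ : ∀ j, n j = 2 * k j)
        -- the loss
        (l : KNNPer.Pred → Fin 2 → ℝ) (_ : KNNPer.BoundedLoss l) (_ : KNNPer.ConvexLoss l)
        (_ : KNNPer.ClassificationErrorLoss l)
        -- the hypothesis class and its VC dimension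
        (H : Set (X → KNNPer.Pred)) (_ : ∀ h ∈ H, Measurable h)
        (_ : ∀ h ∈ H, ∀ x, h x ∈ stdSimplex ℝ (Fin 2))
        (d : ℕ) (_ : KNNPer.HasVCDimension H d) (_ : d ≤ ∑ j, n j)
        -- the global model, trained on the first halves of the data
        (A : KNNPer.Sample X k → X → KNNPer.Pred) (_ : KNNPer.IsERM l H A)
        (_ : Measurable fun q : KNNPer.Sample X k × X => A q.1 q.2)
        -- the representation attached to a hypothesis
        (p : ℕ) (φ : (X → KNNPer.Pred) → X → KNNPer.Rep p)
        (_ : ∀ h ∈ H, ∀ x i, φ h x i ∈ Set.Icc (0 : ℝ) 1)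
        (_ : Measurable fun q : KNNPer.Sample X k × X => φ (A q.1) q.2)
        -- the client, its nearest-neighbour rule and its interpolation parameter
        (m : Fin M) (_ : 0 < k m)
        (ν : (Fin (k m) → KNNPer.Rep p) → KNNPer.Rep p → Fin (k m))
        (_ : KNNPer.IsNearestIndex ν)
        (lam : ℝ) (_ : lam ∈ Set.Ioo (0 : ℝ) 1)
        -- an optimal hypothesis of the client; the Bayes rule is optimal
        (η : X → ℝ) (_ : KNNPer.IsCondProb (D m) η)
        (hstar : X → KNNPer.Pred) (_ : hstar ∈ H)
        (_ : ∀ h ∈ H, KNNPer.risk l (D m) hstar ≤ KNNPer.risk l (D m) h)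
        (_ : KNNPer.risk l (D m) (KNNPer.bayesRule η) ≤ KNNPer.risk l (D m) hstar)
        -- the Lipschitz-type condition
        (_ : ∀ S' x x', |η x - η x'| ≤
          (γ₁ + γ₂ * (KNNPer.risk l (D m) (A S') - KNNPer.risk l (D m) hstar)) *
            dist (φ (A S') x) (φ (A S') x')),
        ∫ S : KNNPer.Sample X k × KNNPer.Sample X k,
            KNNPer.risk l (D m) (KNNPer.personalized A φ m ν lam S.1 S.2)
            ∂((KNNPer.sampleLaw k D).prod (KNNPer.sampleLaw k D)) ≤
          (1 + lam) * KNNPer.risk l (D m) hstar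
          + c₁ * (1 - lam) * KNNPer.disc l H (KNNPer.mixture n D) (D m)
          + c₂ * lam * (√(p : ℝ) / (n m : ℝ) ^ (1 / ((p : ℝ) + 1))) *
              (KNNPer.disc l H (KNNPer.mixture n D) (D m) + 1)
          + c₃ * (1 - lam) * √((d : ℝ) / (∑ j, n j : ℕ)) *
              √(c₄ + Real.log ((∑ j, n j : ℕ) / (d : ℝ)))
          + c₅ * lam * √((d : ℝ) / (∑ j, n j : ℕ)) *
              √(c₄ + Real.log ((∑ j, n j : ℕ) / (d : ℝ))) *
              (√(p : ℝ) / (n m : ℝ) ^ (1 / ((p : ℝ) + 1))) := by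
  refine ⟨2, 6 * (|γ₁| + 2 * |γ₂|), 2, 1, 12 * |γ₂|, ?_⟩
  intro X _ M D _ n k hnk l hb hc he H hHm hHs d hd hdn A hA hAm p φ hφ01 hφm m hkm ν hν lam hlam
    η hη hstar hstarH hopt hbayes hlip
  obtain ⟨ζ, hζ, hζ01, hζb, hζη⟩ := hη.exists_clamp
  have hsum : ∑ j, n j = 2 * ∑ j, k j := by rw [Finset.mul_sum]; simp only [hnk]
  have hk : 0 < ∑ j, k j :=
    hkm.trans_le (Finset.single_le_sum (f := k) (fun _ _ => Nat.zero_le _) (Finset.mem_univ m))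
  rw [mixture_two_mul hnk D, hsum]
  rw [hsum] at hdn
  set P := sampleLaw k D with hP
  set Lm := risk l (D m) hstar with hLm
  set δ := disc l H (mixture k D) (D m) with hδ
  set R : ℝ := √((d : ℝ) / (2 * ∑ j, k j : ℕ)) * √(1 + Real.log ((2 * ∑ j, k j : ℕ) / d))
    with hR
  set ρ : ℝ := √(p : ℝ) / (n m : ℝ) ^ (1 / ((p : ℝ) + 1)) with hρ
  have hρ0 : 0 ≤ ρ := by positivity
  have hAH : ∀ S, A S ∈ H := fun S => (hA S).1
  have hAs : ∀ S x, A S x ∈ stdSimplex ℝ (Fin 2) := fun S => hHs _ (hAH S)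
  have hφS : ∀ S, Measurable (φ (A S)) := fun S => hφm.comp measurable_prodMk_left
  -- the global model
  let R₀ : Sample X k → ℝ := fun S => risk l (D m) (A S)
  have hR₀i : Integrable R₀ P :=
    integrable_of_mem_Icc (measurable_risk hb hc he (D m) hAm hAs) fun S =>
      risk_mem_Icc hb hc he (D m) (hAs S)
  have hR₀ : ∫ S, R₀ S ∂P ≤ Lm + 2 * δ + 2 * R := by
    have := integral_risk_erm_le hb hc he D hHm hHs hd hk hdn A hA hAm hstarH m
    rwa [mul_assoc 2 (√_)] at this
  -- the nearest-neighbour model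
  let R₁ : Sample X k × Sample X k → ℝ := fun q => risk l (D m) (oneNN ν (φ (A q.1)) (q.2 m))
  have hNNs : ∀ (f : X → Rep p) (T : Fin (k m) → X × Fin 2) x,
      oneNN ν f T x ∈ stdSimplex ℝ (Fin 2) := fun f T x => vertex_mem _
  have hR₁m : Measurable R₁ :=
    measurable_risk hb hc he (D m) (measurable_oneNN hν
      (f := fun q : Sample X k × Sample X k => φ (A q.1))
      (hφm.comp (measurable_fst.fst.prodMk measurable_snd))
      (T := fun q : Sample X k × Sample X k => q.2 m) (by fun_prop)) fun q => hNNs _ _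
  have hR₁i : Integrable R₁ (P.prod P) :=
    integrable_of_mem_Icc hR₁m fun q => risk_mem_Icc hb hc he (D m) (hNNs _ _)
  have hR₁ : ∀ S', ∫ S'', R₁ (S', S'') ∂P ≤
      2 * Lm + (|γ₁| + |γ₂| * (R₀ S' - Lm)) * (6 * ρ) := by
    intro S'
    have hmp : MeasurePreserving (fun S : Sample X k => S m) P
        (Measure.pi fun _ : Fin (k m) => D m) :=
      measurePreserving_eval (fun j => Measure.pi fun _ : Fin (k j) => D j) m
    have hK0 : 0 ≤ R₀ S' - Lm := sub_nonneg.2 (hopt _ (hAH S'))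
    have hK : γ₁ + γ₂ * (R₀ S' - Lm) ≤ |γ₁| + |γ₂| * (R₀ S' - Lm) :=
      add_le_add (le_abs_self _) (mul_le_mul_of_nonneg_right (le_abs_self _) hK0)
    have hTm : Measurable fun T : Fin (k m) → X × Fin 2 =>
        risk l (D m) (oneNN ν (φ (A S')) T) :=
      measurable_risk hb hc he (D m) (measurable_oneNN hν
        (f := fun _ : Fin (k m) → X × Fin 2 => φ (A S')) ((hφS S').comp measurable_snd)
        measurable_id) fun _ => hNNs _ _
    have h1 := integral_risk_oneNN_le he hζ hζ01 hν (hφS S') (hφ01 _ (hAH S'))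
      (K := |γ₁| + |γ₂| * (R₀ S' - Lm)) fun x x' => (hζη x x').trans
        ((hlip S' x x').trans (mul_le_mul_of_nonneg_right hK dist_nonneg))
    obtain ⟨T, hT⟩ := exists_grid_size p hkm (hnk m)
    have h2 := integral_dist_nearest_le (D m).fst hkm hν (hφS S') (hφ01 _ (hAH S')) T
    have h3 : √(p : ℝ) * (1 / ((T : ℝ) + 1) + ((T : ℝ) + 1) ^ p / k m) ≤ 6 * ρ := by
      calc _ ≤ √(p : ℝ) * (6 / (n m : ℝ) ^ (1 / ((p : ℝ) + 1))) := by gcongr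
        _ = 6 * ρ := by rw [hρ]; ring
    rw [hζb] at h1
    have h4 : 0 ≤ |γ₁| + |γ₂| * (R₀ S' - Lm) := by positivity
    calc ∫ S'', R₁ (S', S'') ∂P
        = ∫ T, risk l (D m) (oneNN ν (φ (A S')) T) ∂(Measure.pi fun _ : Fin (k m) => D m) :=
          integral_comp_of_measurePreserving hmp hTm.aestronglyMeasurable
      _ ≤ _ := h1.trans (add_le_add (by linarith)
          (mul_le_mul_of_nonneg_left (h2.trans h3) h4))
  have hR₁int : ∫ q, R₁ q ∂P.prod P ≤ 2 * Lm + (|γ₁| + |γ₂| * (2 * δ + 2 * R)) * (6 * ρ) := by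
    rw [integral_prod _ hR₁i]
    have hi1 : Integrable (fun S' => R₀ S' - Lm) P := hR₀i.sub (integrable_const _)
    have hi2 : Integrable (fun S' => |γ₁| + |γ₂| * (R₀ S' - Lm)) P :=
      (integrable_const _).add (hi1.const_mul _)
    refine (integral_mono hR₁i.integral_prod_left
      ((integrable_const _).add (hi2.mul_const _)) hR₁).trans ?_
    simp only [Pi.add_apply]
    rw [integral_add (integrable_const _) (hi2.mul_const _), integral_mul_const (6 * ρ),
      integral_add (integrable_const _) (hi1.const_mul _), integral_const_mul |γ₂|,
      integral_sub hR₀i (integrable_const _)]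
    simp only [integral_const, probReal_univ, one_smul]
    gcongr
    linarith
  -- the personalized model
  have hlam0 : 0 ≤ lam := hlam.1.le
  have hlam1 : 0 ≤ 1 - lam := by linarith [hlam.2]
  have hmain : ∫ S : Sample X k × Sample X k, risk l (D m) (personalized A φ m ν lam S.1 S.2)
      ∂P.prod P ≤ lam * ∫ q, R₁ q ∂P.prod P + (1 - lam) * ∫ S, R₀ S ∂P := by
    have hi0 : Integrable (fun q : Sample X k × Sample X k => R₀ q.1) (P.prod P) :=
      hR₀i.comp_fst _
    have e0 : ∫ q : Sample X k × Sample X k, R₀ q.1 ∂P.prod P = ∫ S, R₀ S ∂P :=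
      integral_comp_of_measurePreserving measurePreserving_fst hR₀i.aestronglyMeasurable
    rw [← e0, ← integral_const_mul, ← integral_const_mul,
      ← integral_add (hR₁i.const_mul _) (hi0.const_mul _)]
    refine integral_mono_of_nonneg (Filter.Eventually.of_forall fun q => ?_)
      ((hR₁i.const_mul _).add (hi0.const_mul _)) (Filter.Eventually.of_forall fun q => ?_)
    · exact (risk_mem_Icc hb hc he (D m) fun x => convex_stdSimplex ℝ (Fin 2) (hNNs _ _ x)
        (hAs q.1 x) hlam0 hlam1 (by ring)).1
    · exact risk_combination_le hb hc he (D m) hlam0 hlam.2.le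
        ((measurable_oneNN hν (f := fun _ : Unit => φ (A q.1)) ((hφS q.1).comp measurable_snd)
          (T := fun _ => q.2 m) measurable_const).comp (measurable_prodMk_left (x := ())))
        (hNNs _ _) (hHm _ (hAH q.1)) (hAs q.1)
  have hfin : lam * ∫ q, R₁ q ∂P.prod P + (1 - lam) * ∫ S, R₀ S ∂P ≤
      lam * (2 * Lm + (|γ₁| + |γ₂| * (2 * δ + 2 * R)) * (6 * ρ)) +
        (1 - lam) * (Lm + 2 * δ + 2 * R) := by gcongr
  have hδ0 : 0 ≤ δ := Real.iSup_nonneg fun _ => abs_nonneg _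
  have hx1 : 0 ≤ lam * ρ * |γ₁| * δ := by positivity
  have hx2 : 0 ≤ lam * ρ * |γ₂| := by positivity
  refine hmain.trans (hfin.trans ?_)
  have e3 : ∀ c : ℝ, c * √((d : ℝ) / (2 * ∑ j, k j : ℕ)) *
      √(1 + Real.log ((2 * ∑ j, k j : ℕ) / d)) = c * R := fun c => mul_assoc _ _ _
  rw [e3, e3]
  nlinarith
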